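/- **Setting.** An underwater optical system has two hops $i=1,2$ (forward and return) with channel gains $h_i=h_a\,h_{t,i}\,h_{p,i}$, where: - $h_a=\exp[-(a(\lambda)+b(\lambda))\,d_{vs}]$ is a deterministic attenuation factor ($a(\lambda),b(\lambda)$ are the absorption and scattering coefficients, $d_{vs}$ is the distance); - the fading $h_{t,i}$ has the mixture Exponential–Generalized Gamma density on $(0,\infty)$ $$f_{h_t}(x)=\frac{\alpha}{\beta}e^{-x/\beta}+(1-\alpha)\frac{c\,x^{ac-1}}{b^{ac}\Gamma(a)}e^{-(x/b)^c},\qquad \alpha\in[0,1],\ \beta,a,b,c>0;$$ - the pointing loss is $h_{p,i}=A_0\exp(-2r_i^2/\omega_e^2)$, where $r_i$ is the Euclidean norm of a planar displacement with independent $\mathcal N(0,\sigma_s^2)$ coordinates, and $v=\frac{r_a\sqrt{\pi/2}}{\omega_b}$, $A_0=\operatorname{erf}^2(v)$, $\omega_e=\omega_b\sqrt{\frac{\sqrt\pi\,\operatorname{erf}(v)}{2v e^{-v^2}}}$ with $r_a,\omega_b,\sigma_s>0$. Put $\mu_s=\omega_e/(2\sigma_s)$. For each $i$ the variables $h_{t,i}$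 and $h_{p,i}$ are independent, and $h_1,h_2$ are independent. Let $h=h_1h_2$ and let the instantaneous return-link SNR be $\gamma_u=\overline\gamma_u h$, where $\overline\gamma_u=(1-\rho)\eta_t\eta_r\eta_sP_t/\sigma_2^2$ with $0\le\rho<1$ and $\eta_t,\eta_r,\eta_s,P_t,\sigma_2>0$. The Fox H-function is the Mellin–Barnes integral $${\rm H}^{m,n}_{p,q}\Bigl[z\Bigm|\substack{(a_1,A_1),\dots,(a_p,A_p)\\(b_1,B_1),\dots,(b_q,B_q)}\Bigr]=\frac1{2\pi i}\int_{\mathcal L}\frac{\prod_{j\le m}\Gamma(b_j-B_js)\prod_{i\le n}\Gamma(1-a_i+A_is)}{\prod_{j>m}\Gamma(1-b_j+B_js)\prod_{i>n}\Gamma(a_i-A_is)}\,z^s\,ds$$ along an upward vertical line $\mathcal L$ with the poles of $\Gamma(b_j-B_js)$, $j\le m$, on its right and those of $\Gamma(1-a_i+A_is)$, $i\le n$, on its left. The Meijer G-function is the case in which all $A_i=B_j=1$. **Theorem.** For every $\gamma>0$ the six Mellin–Barnes integrals below are well defined: separating vertical lines exist, and along each of them the integral converges absolutely, to the same value. The random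 variable $\gamma_u$ is absolutely continuous, with a density $f_{\gamma_u}\ge0$ that vanishes on $(-\infty,0]$ and is given for every $\gamma>0$ by $$\begin{aligned}f_{\gamma_u}(\gamma)&=\frac{(\alpha\mu_s^2)^2}{\gamma}{\rm G}^{4,0}_{2,4}\Bigl[\frac{\gamma\,\overline\gamma_u^{-1}}{(A_0h_a\beta)^2}\Bigm|\substack{\mu_s^2+1,\ \mu_s^2+1\\1,\ \mu_s^2,\ 1,\ \mu_s^2}\Bigr]\\&+\frac{2\alpha(1-\alpha)\mu_s^4}{\Gamma(a)c^2\gamma}{\rm H}^{4,0}_{2,4}\Bigl[\frac{\gamma(\overline\gamma_u\beta b)^{-1}}{(A_0h_a)^2}\Bigm|\substack{(\frac{\mu_s^2}{c}+1,\frac1c),\ (\frac{\mu_s^2}{c}+1,\frac1c)\\(a,\frac1c),\ (\frac{\mu_s^2}{c},\frac1c),\ (1,1),\ (\frac{\mu_s^2}{c},\frac1c)}\Bigr]\\&+\Bigl[\frac{(1-\alpha)\mu_s^2}{\Gamma(a)}\Bigr]^2\frac1{c\gamma}{\rm G}^{4,0}_{2,4}\Bigl[\Bigl[\frac{\gamma\,\overline\gamma_u^{-1}}{(A_0h_ab)^2}\Bigr]^c\Bigm|\substack{\frac{\mu_s^2}{c}+1,\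 \frac{\mu_s^2}{c}+1\\a,\ \frac{\mu_s^2}{c},\ a,\ \frac{\mu_s^2}{c}}\Bigr].\end{aligned}$$ Its cumulative distribution function is given for every $\gamma>0$ by $$\begin{aligned}F_{\gamma_u}(\gamma)&=(\alpha\mu_s^2)^2\,{\rm G}^{4,1}_{3,5}\Bigl[\frac{\gamma\,\overline\gamma_u^{-1}}{(A_0h_a\beta)^2}\Bigm|\substack{1,\ \mu_s^2+1,\ \mu_s^2+1\\1,\ \mu_s^2,\ 1,\ \mu_s^2,\ 0}\Bigr]\\&+\frac{2\alpha(1-\alpha)\mu_s^4}{\Gamma(a)c^2}{\rm H}^{4,1}_{3,5}\Bigl[\frac{\gamma(\overline\gamma_u\beta b)^{-1}}{(A_0h_a)^2}\Bigm|\substack{(1,1),\ (\frac{\mu_s^2}{c}+1,\frac1c),\ (\frac{\mu_s^2}{c}+1,\frac1c)\\(a,\frac1c),\ (\frac{\mu_s^2}{c},\frac1c),\ (1,1),\ (\frac{\mu_s^2}{c},\frac1c),\ (0,1)}\Bigr]\\&+\Bigl[\frac{(1-\alpha)\mu_s^2}{\Gamma(a)c}\Bigr]^2{\rm G}^{4,1}_{3,5}\Bigl[\Bigl[\frac{\gamma\,\overline\gamma_u^{-1}}{(A_0h_ab)^2}\Bigr]^c\Bigm|\substack{1,\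 \frac{\mu_s^2}{c}+1,\ \frac{\mu_s^2}{c}+1\\a,\ \frac{\mu_s^2}{c},\ a,\ \frac{\mu_s^2}{c},\ 0}\Bigr].\end{aligned}$$ Consequently, for every threshold $\gamma_{\rm th}>0$, the outage probability $\Pr(\gamma_u<\gamma_{\rm th})$ equals $F_{\gamma_u}(\gamma_{\rm th})$. -/

import Mathlib

open MeasureTheory ProbabilityTheory

noncomputable section

/-! ### The Fox H-function and the Meijer G-function (real parameters) -/

/-- The Mellin-Barnes kernel of the Fox function `H_{p,q}^{m,n}`, where
`as = [(a₁, A₁), …, (a_p, A_p)]` and `bs = [(b₁, B₁), …, (b_q, B_q)]`: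
`∏_{j ≤ m} Γ(b_j - B_j s) ∏_{i ≤ n} Γ(1 - a_i + A_i s)
  / (∏_{j > m} Γ(1 - b_j + B_j s) ∏_{i > n} Γ(a_i - A_i s))`. -/
def foxHKernel (m n : ℕ) (as bs : List (ℝ × ℝ)) (s : ℂ) : ℂ :=
  (((bs.take m).map fun b => Complex.Gamma ((b.1 : ℂ) - (b.2 : ℂ) * s)).prod *
      ((as.take n).map fun a => Complex.Gamma (1 - (a.1 : ℂ) + (a.2 : ℂ) * s)).prod) /
    (((bs.drop m).map fun b => Complex.Gamma (1 - (b.1 : ℂ) + (b.2 : ℂ) * s)).prod *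
      ((as.drop n).map fun a => Complex.Gamma ((a.1 : ℂ) - (a.2 : ℂ) * s)).prod)

/-- The vertical line `Re s = σ` separates the poles `s = (b_j + k) / B_j` of `Γ(b_j - B_j s)`,
`j ≤ m` (they lie to its right), from the poles `s = (a_i - 1 - k) / A_i` of `Γ(1 - a_i + A_i s)`,
`i ≤ n` (they lie to its left). -/
def SeparatesPoles (m n : ℕ) (as bs : List (ℝ × ℝ)) (σ : ℝ) : Prop :=
  (∀ b ∈ bs.take m, ∀ k : ℕ, σ < (b.1 + k) / b.2) ∧
    (∀ a ∈ as.take n, ∀ k : ℕ, (a.1 - 1 - k) / a.2 < σ)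

/-- The point `σ + i y` of the contour. -/
def contourPoint (σ y : ℝ) : ℂ := (σ : ℂ) + (y : ℂ) * Complex.I

/-- `w` is the value `H_{p,q}^{m,n}[z | as ; bs] = (1 / 2πi) ∫_L kernel(s) z^s ds`:
there is a vertical line separating the two families of poles, and along every such line,
run from `σ - i∞` to `σ + i∞`, the integral converges absolutely and has the value `w`
(on the line, `ds = i dy`). -/
def IsFoxH (m n : ℕ) (as bs : List (ℝ × ℝ)) (z w : ℂ) : Prop :=
  (∃ σ : ℝ, SeparatesPoles m n as bs σ) ∧
    ∀ σ : ℝ, SeparatesPoles m n as bs σ →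
      Integrable (fun y : ℝ => foxHKernel m n as bs (contourPoint σ y) * z ^ contourPoint σ y) ∧
        (1 / (2 * (Real.pi : ℂ))) *
          ∫ y : ℝ, foxHKernel m n as bs (contourPoint σ y) * z ^ contourPoint σ y = w

/-- The Mellin-Barnes integral of `H_{p,q}^{m,n}[z | as ; bs]` is well defined. -/
def FoxHConverges (m n : ℕ) (as bs : List (ℝ × ℝ)) (z : ℂ) : Prop :=
  ∃ w : ℂ, IsFoxH m n as bs z w

open Classical in
/-- The Fox function `H_{p,q}^{m,n}[z | as ; bs]`, with `p = as.length`, `q = bs.length`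
(with the value `0` where its Mellin-Barnes integral is not well defined). -/
def foxH (m n : ℕ) (as bs : List (ℝ × ℝ)) (z : ℂ) : ℂ :=
  if h : FoxHConverges m n as bs z then h.choose else 0

/-- The value of `foxH` is the only possible one. -/
theorem IsFoxH.foxH_eq {m n : ℕ} {as bs : List (ℝ × ℝ)} {z w : ℂ} (h : IsFoxH m n as bs z w) :
    foxH m n as bs z = w := by
  have hc : FoxHConverges m n as bs z := ⟨w, h⟩
  obtain ⟨σ, hσ⟩ := h.1
  rw [foxH, dif_pos hc, ← (hc.choose_spec.2 σ hσ).2, (h.2 σ hσ).2]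

/-- Parameters with unit coefficients, `[(a₁, 1), …, (a_p, 1)]`. -/
def unitCoeffs (as : List ℝ) : List (ℝ × ℝ) := as.map fun a => (a, 1)

/-- The Mellin-Barnes integral of the Meijer function `G_{p,q}^{m,n}[z | as ; bs]` is
well defined. -/
def MeijerGConverges (m n : ℕ) (as bs : List ℝ) (z : ℂ) : Prop :=
  FoxHConverges m n (unitCoeffs as) (unitCoeffs bs) z

/-- The Meijer function `G_{p,q}^{m,n}[z | as ; bs]`, that is the Fox function all of whose
coefficients `A_i`, `B_j` are `1`. -/
def meijerG (m n : ℕ) (as bs : List ℝ) (z : ℂ) : ℂ :=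
  foxH m n (unitCoeffs as) (unitCoeffs bs) z

/-! ### The underwater optical link -/

/-- The error function `erf x = (2 / √π) ∫₀ˣ exp(-t²) dt`. -/
def erf (x : ℝ) : ℝ := 2 / Real.sqrt Real.pi * ∫ t in (0 : ℝ)..x, Real.exp (-t ^ 2)

/-- The deterministic parameters of the two-hop system. -/
structure SystemParams where
  /-- absorption coefficient at the wavelength in use -/
  absorption : ℝ
  /-- scattering coefficient at the wavelength in use -/
  scattering : ℝ
  /-- distance between the submarine and the sensor -/
  dist : ℝ
  /-- mixing coefficient of the mixture Exponential-Generalized Gamma (EGG) law -/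
  α : ℝ
  /-- parameter of the exponential component -/
  β : ℝ
  /-- first shape parameter of the generalized Gamma component -/
  a : ℝ
  /-- scale parameter of the generalized Gamma component -/
  b : ℝ
  /-- second shape parameter of the generalized Gamma component -/
  c : ℝ
  /-- radius of the receiver aperture -/
  ra : ℝ
  /-- beam waist at the receiver plane -/
  ωb : ℝ
  /-- jitter standard deviation in each axis -/
  σs : ℝ
  /-- fraction of the received signal routed to the detector branch -/
  ρ : ℝ
  /-- optical-to-electrical conversion efficiency at the sensor -/
  ηr : ℝ
  /-- electrical-to-optical conversion efficiency at the sensor -/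
  ηt : ℝ
  /-- optical-to-electrical conversion efficiency at the submarine -/
  ηs : ℝ
  /-- forward link optical power -/
  Pt : ℝ
  /-- noise standard deviation at the submarine -/
  σ₂ : ℝ
  α_mem : α ∈ Set.Icc (0 : ℝ) 1
  β_pos : 0 < β
  a_pos : 0 < a
  b_pos : 0 < b
  c_pos : 0 < c
  ra_pos : 0 < ra
  ωb_pos : 0 < ωb
  σs_pos : 0 < σs
  ρ_mem : ρ ∈ Set.Ico (0 : ℝ) 1
  ηr_pos : 0 < ηr
  ηt_pos : 0 < ηt
  ηs_pos : 0 < ηs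
  Pt_pos : 0 < Pt
  σ₂_pos : 0 < σ₂

namespace SystemParams

variable (S : SystemParams)

/-- Beer-Lambert attenuation `h_a = exp(-(a(λ) + b(λ)) d)`. -/
def ha : ℝ := Real.exp (-(S.absorption + S.scattering) * S.dist)

/-- `v = r_a √(π/2) / ω_b`. -/
def v : ℝ := S.ra * Real.sqrt (Real.pi / 2) / S.ωb

/-- The maximum collected power fraction `A₀ = erf(v)²`. -/
def A₀ : ℝ := erf S.v ^ 2

/-- The effective beam width `ω_e = ω_b √(√π erf(v) / (2 v exp(-v²)))`. -/
def ωe : ℝ :=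
  S.ωb * Real.sqrt (Real.sqrt Real.pi * erf S.v / (2 * S.v * Real.exp (-S.v ^ 2)))

/-- `μ_s = ω_e / (2 σ_s)`. -/
def μs : ℝ := S.ωe / (2 * S.σs)

/-- The average return link SNR `(1 - ρ) η_t η_r η_s P_t / σ₂²`. -/
def avgSNR : ℝ := (1 - S.ρ) * S.ηt * S.ηr * S.ηs * S.Pt / S.σ₂ ^ 2

/-- The EGG density of the turbulence fading. -/
def eggDensity (x : ℝ) : ℝ :=
  if 0 < x then
    S.α / S.β * Real.exp (-x / S.β) +
      (1 - S.α) * (S.c * x ^ (S.a * S.c - 1) / (S.b ^ (S.a * S.c) * Real.Gamma S.a)) *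
        Real.exp (-(x / S.b) ^ S.c)
  else 0

/-- The law of the turbulence fading `h_t`. -/
def eggMeasure : Measure ℝ := volume.withDensity fun x => ENNReal.ofReal (S.eggDensity x)

/-- The law of the lateral displacement of the beam: two independent centred Gaussian
coordinates with variance `σ_s²`. -/
def jitterMeasure : Measure (ℝ × ℝ) :=
  (gaussianReal 0 (Real.toNNReal (S.σs ^ 2))).prod (gaussianReal 0 (Real.toNNReal (S.σs ^ 2)))

/-- The pointing loss `h_p = A₀ exp(-2 r² / ω_e²)` at the lateral displacement `p`,
whose radial displacement is `r = √(p₁² + p₂²)`. -/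
def pointingLoss (p : ℝ × ℝ) : ℝ :=
  S.A₀ * Real.exp (-2 * Real.sqrt (p.1 ^ 2 + p.2 ^ 2) ^ 2 / S.ωe ^ 2)

/-- The gain `h_a h_t h_p` of one link, for the fading `t` and the lateral displacement `p`. -/
def linkGain (t : ℝ) (p : ℝ × ℝ) : ℝ := S.ha * t * S.pointingLoss p

variable {Ω : Type*}

/-- The instantaneous return link SNR `γ_u = γ̄_u h₁ h₂`. The forward link has index `0`,
the return link has index `1`. -/
def snr (ht : Fin 2 → Ω → ℝ) (disp : Fin 2 → Ω → ℝ × ℝ) (ω : Ω) : ℝ :=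
  S.avgSNR * (S.linkGain (ht 0 ω) (disp 0 ω) * S.linkGain (ht 1 ω) (disp 1 ω))

/-- The statistical channel model: on each link the fading `h_t` has the EGG law, the lateral
displacement of the beam is Gaussian, and `h_t` is independent of the pointing loss `h_p`;
the gains of the two links are independent. -/
structure IsChannel [MeasurableSpace Ω] (P : Measure Ω)
    (ht : Fin 2 → Ω → ℝ) (disp : Fin 2 → Ω → ℝ × ℝ) : Prop where
  fading_law : ∀ i, HasLaw (ht i) S.eggMeasure P
  jitter_law : ∀ i, HasLaw (disp i) S.jitterMeasure P
  indep_loss : ∀ i, IndepFun (ht i) (fun ω => S.pointingLoss (disp i ω)) P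
  indep_links : IndepFun (fun ω => S.linkGain (ht 0 ω) (disp 0 ω))
    (fun ω => S.linkGain (ht 1 ω) (disp 1 ω)) P

/-! The arguments and the parameter lists of the special functions. -/

/-- `γ γ̄_u⁻¹ / (A₀ h_a β)²`. -/
def argExp (γ : ℝ) : ℝ := γ * S.avgSNR⁻¹ / (S.A₀ * S.ha * S.β) ^ 2

/-- `γ (γ̄_u β b)⁻¹ / (A₀ h_a)²`. -/
def argCross (γ : ℝ) : ℝ := γ * (S.avgSNR * S.β * S.b)⁻¹ / (S.A₀ * S.ha) ^ 2

/-- `[γ γ̄_u⁻¹ / (A₀ h_a b)²]^c`. -/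
def argGamma (γ : ℝ) : ℝ := (γ * S.avgSNR⁻¹ / (S.A₀ * S.ha * S.b) ^ 2) ^ S.c

end SystemParams

end

/-! The SNR factors as `K · T₁T₂ · Z₁Z₂`, with `K` the constant `snrScale`, `Tᵢ` the fading and `Zᵢ
= exp(-2rᵢ²/ω_e²)` the relative pointing loss. Since `rᵢ²` is exponential, `-log Zᵢ` is exponential
with rate `m = μ_s²`, so `-log (Z₁Z₂)` is Gamma with shape 2 and rate `m`. Conditioning on `T =
T₁T₂` gives the SNR density `(m²/y) E[k(y/(KT))]`, where `k(u) = u^m max(-log u, 0)` is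
`logPowKernel` (`map_mul_mconv_eq_withDensity`).

The kernel `k` has Mellin transform `1/(s+m)²`, so inversion writes `k(u)` as the integral of
`u^s/(m-s)²` along a line `Re s = σ < m`. Putting `u = x/t` and averaging over `t` multiplies the
integrand by the moment `E[T^(-s)]` (`integral_negMoment_mul_cpow`). The decay of `1/(m-s)²` and the
finiteness of `E[T^(-σ)]` justify Fubini and give absolute convergence, without any asymptotics of
Gamma functions.

The fading law is a mixture of two generalized Gamma laws, the exponential one having shapes `a = c
= 1`; hence the three terms. A generalized Gamma variable has moment `b^(-s) Γ(a - s/c)/Γ(a)`. The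
other Gamma factors of the special functions form quotients `Γ(w)/Γ(w+1) = 1/w`, which reproduce
`1/(m-s)²` up to a constant (`isFoxH_four_zero`). For the distribution function, integrating
`g^(s-1)` over `(0, x]` contributes `x^s/s` when `σ > 0`, and `1/s` is one more such quotient
(`isFoxH_four_one`). Finally, the change of variable `s ↦ c s` turns the coefficients `1/c` into `1`
and the Fox function of the third term into a Meijer function (`IsFoxH.rescale`). -/

noncomputable section

/-! ### Mellin inversion for the kernel `1 / (m - s)²` -/

/-- The function `u ↦ -u ^ m log u` on `(0, 1)`, extended by zero to `[1, ∞)`. -/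
def logPowKernel (m u : ℝ) : ℝ := max (-Real.log u) 0 * u ^ m

lemma measurable_logPowKernel (m : ℝ) : Measurable (logPowKernel m) := by
  unfold logPowKernel; fun_prop

lemma logPowKernel_nonneg (m : ℝ) {u : ℝ} (hu : 0 ≤ u) : 0 ≤ logPowKernel m u :=
  mul_nonneg (le_max_right _ _) (Real.rpow_nonneg hu _)

lemma continuousAt_logPowKernel (m : ℝ) {u : ℝ} (hu : 0 < u) :
    ContinuousAt (logPowKernel m) u := by
  unfold logPowKernel
  exact ((Real.continuousAt_log hu.ne').neg.max continuousAt_const).mul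
    (Real.continuousAt_rpow_const _ _ (Or.inl hu.ne'))

/-- The transform of `u^m` cut off to `(0, 1]` is `1/(s+m)`. Differentiating in `s` inserts a factor
`log u`, and minus the derivative of `1/(s+m)` is `1/(s+m)²`. -/
lemma hasMellin_logPowKernel {m : ℝ} {s : ℂ} (hs : -m < s.re) :
    HasMellin (fun t => (logPowKernel m t : ℂ)) s (1 / (s + m) ^ 2) := by
  set g : ℝ → ℂ := Set.indicator (Set.Ioc 0 1) (fun t => (t : ℂ) ^ (m : ℂ)) with hg
  have hgm : ∀ z : ℂ, -m < z.re → HasMellin g z (1 / (z + m)) := fun z hz =>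
    hasMellin_cpow_Ioc (m : ℂ) (by simp; linarith)
  have hloc : LocallyIntegrableOn g (Set.Ioi 0) := by
    have : LocallyIntegrableOn (fun t : ℝ => (t : ℂ) ^ (m : ℂ)) (Set.Ioi 0) := by
      apply ContinuousOn.locallyIntegrableOn _ measurableSet_Ioi
      intro t ht
      exact ((Complex.continuousAt_ofReal_cpow_const t m (Or.inr (ne_of_gt ht)))).continuousWithinAt
    intro t ht
    obtain ⟨U, hU, hi⟩ := this t ht
    exact ⟨U, hU, IntegrableOn.indicator hi measurableSet_Ioc⟩
  -- The function vanishes beyond 1, so any exponent above `s.re` would do.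
  have htop : g =O[Filter.atTop] (fun t : ℝ => t ^ (-(s.re + 1))) := by
    refine Filter.EventuallyEq.trans_isBigO (f₂ := fun _ => (0 : ℂ)) ?_
      (Asymptotics.isBigO_zero _ _)
    filter_upwards [Filter.eventually_gt_atTop 1] with t ht
    exact Set.indicator_of_notMem (fun h => absurd h.2 (not_le.2 ht)) _
  have hbot : g =O[nhdsWithin 0 (Set.Ioi 0)] (fun t : ℝ => t ^ (-(-m))) := by
    refine Asymptotics.IsBigO.of_bound 1 ?_
    filter_upwards [self_mem_nhdsWithin] with t ht
    have ht' : (0 : ℝ) < t := ht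
    rw [neg_neg, one_mul]
    refine (norm_indicator_le_norm_self _ _).trans ?_
    rw [Complex.norm_cpow_eq_rpow_re_of_pos ht', Complex.ofReal_re]
    exact le_abs_self _
  obtain ⟨hc, hd⟩ := mellin_hasDerivAt_of_isBigO_rpow hloc htop (by linarith) hbot hs
  have hne : s + (m : ℂ) ≠ 0 := by
    intro h
    have := congrArg Complex.re h
    simp at this
    linarith
  have hd2 : HasDerivAt (mellin g) (-1 / (s + m) ^ 2) s := by
    have h1 : HasDerivAt (fun z : ℂ => 1 / (z + m)) (-1 / (s + m) ^ 2) s := by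
      simpa using ((hasDerivAt_id s).add_const (m : ℂ)).fun_inv hne
    refine h1.congr_of_eventuallyEq ?_
    have ho : IsOpen {z : ℂ | -m < z.re} := isOpen_lt continuous_const Complex.continuous_re
    filter_upwards [ho.mem_nhds hs] with z hz
    exact (hgm z hz).2
  have heq : Set.EqOn (fun t : ℝ => (t : ℂ) ^ (s - 1) • (logPowKernel m t : ℂ))
      (fun t : ℝ => -((t : ℂ) ^ (s - 1) • ((Real.log t) • g t))) (Set.Ioi 0) := by
    intro t ht
    have ht' : (0 : ℝ) < t := ht
    simp only [smul_eq_mul, Complex.real_smul, hg, logPowKernel]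
    rcases le_or_gt t 1 with h1 | h1
    · rw [Set.indicator_of_mem (show t ∈ Set.Ioc (0 : ℝ) 1 from ⟨ht', h1⟩), max_eq_left (by
        have := Real.log_nonpos ht'.le h1; linarith)]
      push_cast [Complex.ofReal_cpow ht'.le]
      ring
    · rw [Set.indicator_of_notMem (show t ∉ Set.Ioc (0 : ℝ) 1 from fun h =>
        absurd h.2 (not_le.2 h1)), max_eq_right (by
        have := Real.log_nonneg h1.le; linarith)]
      simp
  refine ⟨?_, ?_⟩
  · exact (integrableOn_congr_fun heq measurableSet_Ioi).2 hc.neg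
  · rw [mellin, setIntegral_congr_fun measurableSet_Ioi heq, integral_neg]
    have := hd.unique hd2
    rw [mellin] at this
    rw [this]
    ring

lemma contourPoint_re (σ y : ℝ) : (contourPoint σ y).re = σ := by simp [contourPoint]

lemma contourPoint_im (σ y : ℝ) : (contourPoint σ y).im = y := by simp [contourPoint]

lemma continuous_contourPoint (σ : ℝ) : Continuous (contourPoint σ) := by
  unfold contourPoint; fun_prop

lemma sub_contourPoint_ne_zero {m σ : ℝ} (h : σ < m) (y : ℝ) :
    (m : ℂ) - contourPoint σ y ≠ 0 := by
  intro h0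
  have := congrArg Complex.re h0
  simp [contourPoint_re] at this
  linarith

lemma norm_ofReal_cpow_contourPoint {x : ℝ} (hx : 0 < x) (σ y : ℝ) :
    ‖(x : ℂ) ^ contourPoint σ y‖ = x ^ σ := by
  rw [Complex.norm_cpow_eq_rpow_re_of_pos hx, contourPoint_re]

/-- On the line, `|m - s|² = (m-σ)² + y²`, so the norm is a Cauchy profile. This decay is the source
of every absolute convergence below. -/
lemma integrable_inv_sub_contourPoint_sq {m σ : ℝ} (h : σ < m) :
    Integrable fun y : ℝ => 1 / ((m : ℂ) - contourPoint σ y) ^ 2 := by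
  set d := m - σ with hd
  have hd0 : 0 < d := sub_pos.2 h
  have hi : Integrable fun y : ℝ => (d ^ 2)⁻¹ * (1 + (d⁻¹ * y) ^ 2)⁻¹ :=
    (integrable_inv_one_add_sq.comp_mul_left' (inv_pos.2 hd0).ne').const_mul _
  refine hi.mono' ?_ (Filter.Eventually.of_forall fun y => ?_)
  · refine (Continuous.div continuous_const ?_ ?_).aestronglyMeasurable
    · exact (continuous_const.sub (continuous_contourPoint σ)).pow 2
    · exact fun y => pow_ne_zero 2 (sub_contourPoint_ne_zero h y)
  · have : ‖(m : ℂ) - contourPoint σ y‖ ^ 2 = d ^ 2 + y ^ 2 := by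
      rw [← Complex.normSq_eq_norm_sq, Complex.normSq_apply]
      simp [contourPoint_re, contourPoint_im]
      ring
    rw [norm_div, norm_one, norm_pow, this, one_div, ← mul_inv]
    apply le_of_eq
    congr 1
    field_simp

/-- Mellin inversion. It holds at every `u > 0`, including `u = 1`, because the factor `-log u`
makes the cut-off continuous there. -/
lemma integral_inv_sub_sq_mul_cpow {m σ u : ℝ} (h : σ < m) (hu : 0 < u) :
    (1 / (2 * (Real.pi : ℂ))) *
      ∫ y : ℝ, 1 / ((m : ℂ) - contourPoint σ y) ^ 2 * (u : ℂ) ^ contourPoint σ y =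
        logPowKernel m u := by
  have hF : ∀ y : ℝ, mellin (fun t => (logPowKernel m t : ℂ)) (((-σ : ℝ) : ℂ) + y * Complex.I) =
      1 / ((m : ℂ) - contourPoint σ (-y)) ^ 2 := by
    intro y
    rw [(hasMellin_logPowKernel (m := m) (by simp; linarith)).2, contourPoint]
    push_cast
    ring_nf
  have hinv := mellinInv_mellin_eq (-σ) (fun t => (logPowKernel m t : ℂ)) hu
    (hasMellin_logPowKernel (m := m) (by simp; linarith)).1
    (by
      unfold Complex.VerticalIntegrable
      simp_rw [hF]
      exact (integrable_inv_sub_contourPoint_sq h).comp_neg)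
    (Complex.continuous_ofReal.continuousAt.comp (continuousAt_logPowKernel m hu))
  rw [← hinv, mellinInv]
  simp_rw [hF]
  rw [Complex.real_smul]
  push_cast
  congr 1
  -- Mellin inversion uses `u^(-s)` on the line `Re s = -σ`; reversing `y` passes to `u^s` on `Re s
  -- = σ`.
  rw [← integral_neg_eq_self]
  congr 1
  ext y
  rw [smul_eq_mul, mul_comm]
  congr 2
  rw [contourPoint]
  push_cast
  ring

/-! ### Mellin-Barnes representation of a multiplicative mixture -/

/-- The complex moment `∫ t ^ (-s) dN(t)` of a measure on the half-line. -/
def negMoment (N : Measure ℝ) (s : ℂ) : ℂ := ∫ t, (t : ℂ) ^ (-s) ∂N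

section Mixture

variable {N : Measure ℝ} {m σ x : ℝ}

/-- The norm of the integrand is a product of a function of `y` and `t^(-σ)`, so finiteness of the
moment of order `-σ` is all that Fubini needs. -/
lemma integrable_mixture_prod (hN : ∀ᵐ t ∂N, 0 < t) (hσ : σ < m) (hx : 0 < x)
    (hint : Integrable (fun t => t ^ (-σ)) N) :
    Integrable (fun p : ℝ × ℝ => 1 / ((m : ℂ) - contourPoint σ p.1) ^ 2 *
      (((x / p.2 : ℝ) : ℂ) ^ contourPoint σ p.1)) (volume.prod N) := by
  have h1 : Integrable (fun p : ℝ × ℝ => x ^ σ * (‖1 / ((m : ℂ) - contourPoint σ p.1) ^ 2‖ *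
      p.2 ^ (-σ))) (volume.prod N) :=
    (((integrable_inv_sub_contourPoint_sq hσ).norm).mul_prod hint).const_mul _
  refine h1.mono' ?_ ?_
  · refine Measurable.aestronglyMeasurable ?_
    have := (continuous_contourPoint σ).measurable
    fun_prop
  · have hN' : ∀ᵐ p ∂((volume : Measure ℝ).prod N), 0 < p.2 :=
      Measure.quasiMeasurePreserving_snd.ae hN
    filter_upwards [hN'] with p hp
    rw [norm_mul, norm_ofReal_cpow_contourPoint (div_pos hx hp), Real.div_rpow hx.le hp.le,
      Real.rpow_neg hp.le, div_eq_mul_inv]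
    apply le_of_eq
    ring

lemma negMoment_mul_cpow (hN : ∀ᵐ t ∂N, 0 < t) (hx : 0 < x) (s : ℂ) :
    negMoment N s * (x : ℂ) ^ s = ∫ t, ((x / t : ℝ) : ℂ) ^ s ∂N := by
  rw [negMoment, ← integral_mul_const]
  refine integral_congr_ae ?_
  filter_upwards [hN] with t ht
  rw [Complex.ofReal_div, Complex.div_cpow_ofReal_nonneg hx.le ht.le, Complex.cpow_neg]
  ring

lemma integrable_negMoment_mul_cpow [SFinite N] (hN : ∀ᵐ t ∂N, 0 < t) (hσ : σ < m) (hx : 0 < x)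
    (hint : Integrable (fun t => t ^ (-σ)) N) :
    Integrable fun y : ℝ => negMoment N (contourPoint σ y) / ((m : ℂ) - contourPoint σ y) ^ 2 *
      (x : ℂ) ^ contourPoint σ y := by
  refine (integrable_mixture_prod hN hσ hx hint).integral_prod_left.congr
    (Filter.Eventually.of_forall fun y => ?_)
  simp only
  rw [integral_const_mul, ← negMoment_mul_cpow hN hx]
  ring

/-- No estimate of the kernel is needed: for almost every `t` it is the inner integral of a function
integrable on the product, up to the factor `1/(2π)`. -/
lemma integrable_logPowKernel_div [SFinite N] (hN : ∀ᵐ t ∂N, 0 < t) (hσ : σ < m) (hx : 0 < x)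
    (hint : Integrable (fun t => t ^ (-σ)) N) :
    Integrable (fun t => logPowKernel m (x / t)) N := by
  have h := ((integrable_mixture_prod hN hσ hx hint).integral_prod_right).const_mul
    (1 / (2 * (Real.pi : ℂ)))
  refine h.re.congr ?_
  filter_upwards [hN] with t ht
  rw [integral_inv_sub_sq_mul_cpow hσ (div_pos hx ht)]
  simp

lemma integral_negMoment_mul_cpow [SFinite N] (hN : ∀ᵐ t ∂N, 0 < t) (hσ : σ < m) (hx : 0 < x)
    (hint : Integrable (fun t => t ^ (-σ)) N) :
    (1 / (2 * (Real.pi : ℂ))) *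
      ∫ y : ℝ, negMoment N (contourPoint σ y) / ((m : ℂ) - contourPoint σ y) ^ 2 *
        (x : ℂ) ^ contourPoint σ y = ((∫ t, logPowKernel m (x / t) ∂N : ℝ) : ℂ) := by
  have h1 : ∀ y : ℝ, negMoment N (contourPoint σ y) / ((m : ℂ) - contourPoint σ y) ^ 2 *
        (x : ℂ) ^ contourPoint σ y = ∫ t, 1 / ((m : ℂ) - contourPoint σ y) ^ 2 *
      (((x / t : ℝ) : ℂ) ^ contourPoint σ y) ∂N := by
    intro y
    rw [integral_const_mul, ← negMoment_mul_cpow hN hx]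
    ring
  simp_rw [h1]
  rw [integral_integral_swap (integrable_mixture_prod hN hσ hx hint), ← integral_const_mul,
    ← integral_complex_ofReal]
  refine integral_congr_ae ?_
  filter_upwards [hN] with t ht
  exact integral_inv_sub_sq_mul_cpow hσ (div_pos hx ht)

end Mixture

/-! ### Integrating a Mellin-Barnes integral -/

section Primitive

variable {Φ : ℝ → ℂ} {σ x : ℝ}

/-- Positivity of `σ` makes `g^(σ-1)` integrable at 0. It is also the condition that the contour lie
to the right of the pole of `1/s`. -/
lemma integrable_prod_mul_cpow_sub_one (hΦ : Integrable Φ) (hσ : 0 < σ) :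
    Integrable (fun p : ℝ × ℝ => Φ p.1 * (p.2 : ℂ) ^ (contourPoint σ p.1 - 1))
      (volume.prod (volume.restrict (Set.Ioc 0 x))) := by
  have hr : IntegrableOn (fun g : ℝ => g ^ (σ - 1)) (Set.Ioc 0 x) :=
    (intervalIntegral.intervalIntegrable_rpow' (by linarith)).1
  refine (hΦ.norm.mul_prod hr).mono' ?_ ?_
  · refine (hΦ.1.comp_fst).mul ?_
    refine Measurable.aestronglyMeasurable ?_
    have := (continuous_contourPoint σ).measurable
    fun_prop
  · have : ∀ᵐ p ∂((volume : Measure ℝ).prod (volume.restrict (Set.Ioc 0 x))), p.2 ∈ Set.Ioc 0 x :=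
      Measure.quasiMeasurePreserving_snd.ae (ae_restrict_mem measurableSet_Ioc)
    filter_upwards [this] with p hp
    rw [norm_mul, Complex.norm_cpow_eq_rpow_re_of_pos hp.1]
    simp [contourPoint_re]

lemma integral_cpow_sub_one (hσ : 0 < σ) (hx : 0 < x) (y : ℝ) :
    ∫ g in Set.Ioc 0 x, (g : ℂ) ^ (contourPoint σ y - 1) =
      (x : ℂ) ^ contourPoint σ y / contourPoint σ y := by
  rw [← intervalIntegral.integral_of_le hx.le,
    integral_cpow (Or.inl (by simp [contourPoint_re, hσ]))]
  have : contourPoint σ y ≠ 0 := fun h => by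
    have := congrArg Complex.re h
    simp [contourPoint_re] at this
    linarith
  simp [Complex.zero_cpow this]

lemma integrable_mul_cpow_div (hΦ : Integrable Φ) (hσ : 0 < σ) (hx : 0 < x) :
    Integrable fun y : ℝ => Φ y / contourPoint σ y * (x : ℂ) ^ contourPoint σ y := by
  refine (integrable_prod_mul_cpow_sub_one (x := x) hΦ hσ).integral_prod_left.congr
    (Filter.Eventually.of_forall fun y => ?_)
  simp only
  rw [integral_const_mul, integral_cpow_sub_one hσ hx]
  ring

variable {W : ℝ → ℝ}

lemma integral_prod_right_eq_div
    (hW : ∀ g : ℝ, 0 < g → (1 / (2 * (Real.pi : ℂ))) *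
      ∫ y : ℝ, Φ y * (g : ℂ) ^ contourPoint σ y = W g) {g : ℝ} (hg : 0 < g) :
    (1 / (2 * (Real.pi : ℂ))) * ∫ y : ℝ, Φ y * (g : ℂ) ^ (contourPoint σ y - 1) =
      ((W g / g : ℝ) : ℂ) := by
  have hg' : (g : ℂ) ≠ 0 := by exact_mod_cast hg.ne'
  simp_rw [Complex.cpow_sub _ _ hg', Complex.cpow_one, ← mul_div_assoc]
  rw [integral_div, ← mul_div_assoc, hW g hg]
  push_cast
  rfl

lemma integrableOn_div_of_mellinBarnes (hΦ : Integrable Φ) (hσ : 0 < σ)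
    (hW : ∀ g : ℝ, 0 < g → (1 / (2 * (Real.pi : ℂ))) *
      ∫ y : ℝ, Φ y * (g : ℂ) ^ contourPoint σ y = W g) :
    IntegrableOn (fun g => W g / g) (Set.Ioc 0 x) := by
  have h := ((integrable_prod_mul_cpow_sub_one (x := x) hΦ hσ).integral_prod_right).const_mul
    (1 / (2 * (Real.pi : ℂ)))
  refine h.re.congr ?_
  filter_upwards [ae_restrict_mem measurableSet_Ioc] with g hg
  rw [integral_prod_right_eq_div hW hg.1]
  exact Complex.ofReal_re _

lemma integral_div_of_mellinBarnes (hΦ : Integrable Φ) (hσ : 0 < σ) (hx : 0 < x)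
    (hW : ∀ g : ℝ, 0 < g → (1 / (2 * (Real.pi : ℂ))) *
      ∫ y : ℝ, Φ y * (g : ℂ) ^ contourPoint σ y = W g) :
    (1 / (2 * (Real.pi : ℂ))) *
      ∫ y : ℝ, Φ y / contourPoint σ y * (x : ℂ) ^ contourPoint σ y =
        ((∫ g in Set.Ioc 0 x, W g / g : ℝ) : ℂ) := by
  have h1 : ∀ y : ℝ, Φ y / contourPoint σ y * (x : ℂ) ^ contourPoint σ y =
      ∫ g in Set.Ioc 0 x, Φ y * (g : ℂ) ^ (contourPoint σ y - 1) := by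
    intro y
    rw [integral_const_mul, integral_cpow_sub_one hσ hx]
    ring
  simp_rw [h1]
  rw [integral_integral_swap (integrable_prod_mul_cpow_sub_one hΦ hσ), ← integral_const_mul,
    ← integral_complex_ofReal]
  refine integral_congr_ae ?_
  filter_upwards [ae_restrict_mem measurableSet_Ioc] with g hg
  exact integral_prod_right_eq_div hW hg.1

end Primitive

/-! ### The generalized Gamma law -/

/-- The generalized Gamma density with shapes `a`, `c` and scale `b`. -/
def genGammaDensity (a b c x : ℝ) : ℝ :=
  if 0 < x then c * x ^ (a * c - 1) / (b ^ (a * c) * Real.Gamma a) * Real.exp (-(x / b) ^ c) else 0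

/-- The generalized Gamma law with shapes `a`, `c` and scale `b`. -/
def genGammaMeasure (a b c : ℝ) : Measure ℝ :=
  volume.withDensity fun x => ENNReal.ofReal (genGammaDensity a b c x)

instance (a b c : ℝ) : SFinite (genGammaMeasure a b c) := by
  unfold genGammaMeasure; infer_instance

lemma measurable_genGammaDensity (a b c : ℝ) : Measurable (genGammaDensity a b c) := by
  unfold genGammaDensity
  exact Measurable.ite measurableSet_Ioi (by fun_prop) measurable_const

section

variable {a b c : ℝ}

lemma genGammaDensity_nonneg (ha : 0 < a) (hb : 0 < b) (hc : 0 < c) (x : ℝ) :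
    0 ≤ genGammaDensity a b c x := by
  unfold genGammaDensity
  split_ifs
  · have := Real.Gamma_pos_of_pos ha
    positivity
  · exact le_rfl

lemma ae_pos_genGammaMeasure : ∀ᵐ t ∂genGammaMeasure a b c, 0 < t := by
  rw [genGammaMeasure, ae_withDensity_iff (measurable_genGammaDensity a b c).ennreal_ofReal]
  refine Filter.Eventually.of_forall fun x hx => ?_
  by_contra h
  exact hx (by simp [genGammaDensity, h])

/-- The nested functions exhibit `exp(-v)` composed with `u ↦ u^c` and `t ↦ b⁻¹ t`, the shape to
which the scaling and power rules of the Mellin transform apply. -/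
lemma ofReal_genGammaDensity_mul_cpow (s : ℂ) :
    (fun t : ℝ => genGammaDensity a b c t • (t : ℂ) ^ (-s)) =
      (Set.Ioi 0).indicator fun t : ℝ => ((c / (b ^ (a * c) * Real.Gamma a) : ℝ) : ℂ) •
        ((t : ℂ) ^ (((a * c : ℝ) : ℂ) - s - 1) • (fun u : ℝ =>
          (fun v : ℝ => ((Real.exp (-v) : ℝ) : ℂ)) (u ^ c)) (b⁻¹ * t)) := by
  ext t
  by_cases ht : 0 < t
  · rw [Set.indicator_of_mem (show t ∈ Set.Ioi (0 : ℝ) from ht), genGammaDensity, if_pos ht]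
    have h0 : (t : ℂ) ≠ 0 := by exact_mod_cast ht.ne'
    have : ((a * c : ℝ) : ℂ) - s - 1 = ((a * c - 1 : ℝ) : ℂ) + -s := by push_cast; ring
    rw [this, Complex.cpow_add _ _ h0, ← Complex.ofReal_cpow ht.le, div_eq_inv_mul t b]
    simp only [Complex.real_smul, smul_eq_mul]
    push_cast
    ring
  · rw [Set.indicator_of_notMem (show t ∉ Set.Ioi (0 : ℝ) from ht), genGammaDensity, if_neg ht,
      zero_smul]

lemma mellinConvergent_exp_neg_rpow (hb : 0 < b) (hc : 0 < c) {z : ℂ} (hz : 0 < z.re) :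
    MellinConvergent (fun t : ℝ => (fun u : ℝ =>
      (fun v : ℝ => ((Real.exp (-v) : ℝ) : ℂ)) (u ^ c)) (b⁻¹ * t)) z := by
  rw [MellinConvergent.comp_mul_left (f := fun u : ℝ =>
    (fun v : ℝ => ((Real.exp (-v) : ℝ) : ℂ)) (u ^ c)) (inv_pos.2 hb),
    MellinConvergent.comp_rpow (f := fun v : ℝ => ((Real.exp (-v) : ℝ) : ℂ)) hc.ne']
  have : 0 < (z / c).re := by
    rw [Complex.div_ofReal_re]; positivity
  refine (Complex.GammaIntegral_convergent this).congr_fun (fun t _ => ?_) measurableSet_Ioi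
  simp [mul_comm]

lemma mellin_exp_neg_rpow (hb : 0 < b) (hc : 0 < c) {z : ℂ} (hz : 0 < z.re) :
    mellin (fun t : ℝ => (fun u : ℝ =>
      (fun v : ℝ => ((Real.exp (-v) : ℝ) : ℂ)) (u ^ c)) (b⁻¹ * t)) z =
        (b : ℂ) ^ z * ((c : ℂ)⁻¹ * Complex.Gamma (z / c)) := by
  rw [mellin_comp_mul_left (fun u : ℝ =>
    (fun v : ℝ => ((Real.exp (-v) : ℝ) : ℂ)) (u ^ c)) _ (inv_pos.2 hb),
    mellin_comp_rpow (fun v : ℝ => ((Real.exp (-v) : ℝ) : ℂ)), ← Complex.GammaIntegral_eq_mellin,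
    Complex.Gamma_eq_integral (by rw [Complex.div_ofReal_re]; positivity), abs_of_pos hc,
    Complex.ofReal_inv, Complex.inv_cpow _ _ (by
      rw [Complex.arg_ofReal_of_nonneg hb.le]; exact Real.pi_ne_zero.symm),
    Complex.cpow_neg, inv_inv, Complex.real_smul, smul_eq_mul, Complex.ofReal_inv]

lemma integrable_cpow_genGammaMeasure (ha : 0 < a) (hb : 0 < b) (hc : 0 < c) {s : ℂ}
    (hs : s.re < a * c) : Integrable (fun t : ℝ => (t : ℂ) ^ (-s)) (genGammaMeasure a b c) := by
  rw [genGammaMeasure, integrable_withDensity_iff_integrable_smul₀'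
    (measurable_genGammaDensity a b c).ennreal_ofReal.aemeasurable
    (Filter.Eventually.of_forall fun _ => ENNReal.ofReal_lt_top)]
  simp_rw [ENNReal.toReal_ofReal (genGammaDensity_nonneg ha hb hc _)]
  rw [ofReal_genGammaDensity_mul_cpow, integrable_indicator_iff measurableSet_Ioi]
  have h := mellinConvergent_exp_neg_rpow hb hc (z := ((a * c : ℝ) : ℂ) - s) (by simpa using hs)
  exact Integrable.smul ((c / (b ^ (a * c) * Real.Gamma a) : ℝ) : ℂ) h

/-- The substitution `v = (t/b)^c` leads to a Gamma integral; `s.re < a c` is its convergence at 0.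
-/
lemma negMoment_genGammaMeasure (ha : 0 < a) (hb : 0 < b) (hc : 0 < c) {s : ℂ}
    (hs : s.re < a * c) : negMoment (genGammaMeasure a b c) s =
      (b : ℂ) ^ (-s) * Complex.Gamma (a - s / c) / Real.Gamma a := by
  rw [negMoment, genGammaMeasure, integral_withDensity_eq_integral_toReal_smul₀
    (measurable_genGammaDensity a b c).ennreal_ofReal.aemeasurable
    (Filter.Eventually.of_forall fun _ => ENNReal.ofReal_lt_top)]
  simp_rw [ENNReal.toReal_ofReal (genGammaDensity_nonneg ha hb hc _)]
  rw [ofReal_genGammaDensity_mul_cpow, integral_indicator measurableSet_Ioi, integral_smul]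
  have h := mellin_exp_neg_rpow hb hc (z := ((a * c : ℝ) : ℂ) - s) (by simpa using hs)
  rw [mellin] at h
  rw [h]
  have hb' : (b : ℂ) ≠ 0 := by exact_mod_cast hb.ne'
  have hc' : (c : ℂ) ≠ 0 := by exact_mod_cast hc.ne'
  have hpow : ((b ^ (a * c) : ℝ) : ℂ) ≠ 0 := by
    exact_mod_cast (Real.rpow_pos_of_pos hb _).ne'
  have hG : (Real.Gamma a : ℂ) ≠ 0 := by exact_mod_cast (Real.Gamma_pos_of_pos ha).ne'
  have harg : (((a * c : ℝ) : ℂ) - s) / c = a - s / c := by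
    push_cast; field_simp
  rw [harg, sub_eq_add_neg ((a * c : ℝ) : ℂ), Complex.cpow_add _ _ hb', ← Complex.ofReal_cpow hb.le,
    smul_eq_mul, Complex.ofReal_div, Complex.ofReal_mul]
  field_simp

end

/-! ### Moments of multiplicative convolutions -/

section

variable {μ ν : Measure ℝ}

lemma ae_pos_prod (hμ : ∀ᵐ t ∂μ, 0 < t) (hν : ∀ᵐ t ∂ν, 0 < t) :
    ∀ᵐ p ∂μ.prod ν, 0 < p.1 ∧ 0 < p.2 :=
  (Measure.quasiMeasurePreserving_fst.ae hμ).and (Measure.quasiMeasurePreserving_snd.ae hν)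

lemma ae_pos_mconv [SFinite μ] [SFinite ν] (hμ : ∀ᵐ t ∂μ, 0 < t) (hν : ∀ᵐ t ∂ν, 0 < t) :
    ∀ᵐ t ∂(μ ∗ₘ ν), 0 < t := by
  rw [Measure.mconv, ae_map_iff (by fun_prop) measurableSet_Ioi]
  filter_upwards [ae_pos_prod hμ hν] with p hp
  exact mul_pos hp.1 hp.2

lemma integrable_cpow_mconv [SFinite μ] [SFinite ν] (hμ : ∀ᵐ t ∂μ, 0 < t)
    (hν : ∀ᵐ t ∂ν, 0 < t) {s : ℂ}
    (h1 : Integrable (fun t : ℝ => (t : ℂ) ^ (-s)) μ)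
    (h2 : Integrable (fun t : ℝ => (t : ℂ) ^ (-s)) ν) :
    Integrable (fun t : ℝ => (t : ℂ) ^ (-s)) (μ ∗ₘ ν) := by
  rw [Measure.mconv, integrable_map_measure
    (by exact Measurable.aestronglyMeasurable (by fun_prop)) (by fun_prop)]
  refine (h1.mul_prod h2).congr ?_
  filter_upwards [ae_pos_prod hμ hν] with p hp
  simp [Complex.mul_cpow_ofReal_nonneg hp.1.le hp.2.le]

lemma negMoment_mconv [SFinite μ] [SFinite ν] (hμ : ∀ᵐ t ∂μ, 0 < t) (hν : ∀ᵐ t ∂ν, 0 < t) (s : ℂ) :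
    negMoment (μ ∗ₘ ν) s = negMoment μ s * negMoment ν s := by
  rw [negMoment, Measure.mconv, integral_map (by fun_prop)
    (by exact Measurable.aestronglyMeasurable (by fun_prop)), negMoment, negMoment,
    ← integral_prod_mul]
  refine integral_congr_ae ?_
  filter_upwards [ae_pos_prod hμ hν] with p hp
  simp [Complex.mul_cpow_ofReal_nonneg hp.1.le hp.2.le]

end

lemma integrable_rpow_of_cpow {μ : Measure ℝ} (hμ : ∀ᵐ t ∂μ, 0 < t) {σ : ℝ}
    (h : Integrable (fun t : ℝ => (t : ℂ) ^ (-(σ : ℂ))) μ) :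
    Integrable (fun t : ℝ => t ^ (-σ)) μ := by
  refine h.re.congr ?_
  filter_upwards [hμ] with t ht
  rw [← Complex.ofReal_neg, ← Complex.ofReal_cpow ht.le]
  exact Complex.ofReal_re _

/-! ### Mellin-Barnes integrals of products of generalized Gamma variables -/

section Pair

variable {m a₁ b₁ c₁ a₂ b₂ c₂ σ z : ℝ}

/-- The mean of `logPowKernel m (x / (t₁ t₂))` over independent generalized Gamma `t₁`, `t₂`. -/
def genGammaMixture (m a₁ b₁ c₁ a₂ b₂ c₂ x : ℝ) : ℝ :=
  ∫ t, logPowKernel m (x / t) ∂(genGammaMeasure a₁ b₁ c₁ ∗ₘ genGammaMeasure a₂ b₂ c₂)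

lemma ae_pos_genGammaMeasure_mconv :
    ∀ᵐ t ∂(genGammaMeasure a₁ b₁ c₁ ∗ₘ genGammaMeasure a₂ b₂ c₂), 0 < t :=
  ae_pos_mconv ae_pos_genGammaMeasure ae_pos_genGammaMeasure

lemma integrable_rpow_genGammaMeasure_mconv (ha₁ : 0 < a₁) (hb₁ : 0 < b₁) (hc₁ : 0 < c₁)
    (ha₂ : 0 < a₂) (hb₂ : 0 < b₂) (hc₂ : 0 < c₂) (h₁ : σ < a₁ * c₁) (h₂ : σ < a₂ * c₂) :
    Integrable (fun t => t ^ (-σ)) (genGammaMeasure a₁ b₁ c₁ ∗ₘ genGammaMeasure a₂ b₂ c₂) :=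
  integrable_rpow_of_cpow ae_pos_genGammaMeasure_mconv
    (integrable_cpow_mconv ae_pos_genGammaMeasure ae_pos_genGammaMeasure
      (integrable_cpow_genGammaMeasure ha₁ hb₁ hc₁ (by simpa using h₁))
      (integrable_cpow_genGammaMeasure ha₂ hb₂ hc₂ (by simpa using h₂)))

/-- The two Gamma factors are, up to normalization, the moment of a product of independent
generalized Gamma variables. The scales `b₁`, `b₂` only rescale the argument. -/
lemma Gamma_mul_Gamma_mul_cpow (ha₁ : 0 < a₁) (hb₁ : 0 < b₁) (hc₁ : 0 < c₁)
    (ha₂ : 0 < a₂) (hb₂ : 0 < b₂) (hc₂ : 0 < c₂) (hz : 0 < z) {s : ℂ}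
    (h₁ : s.re < a₁ * c₁) (h₂ : s.re < a₂ * c₂) :
    Complex.Gamma (a₁ - s / c₁) * Complex.Gamma (a₂ - s / c₂) * (z : ℂ) ^ s =
      ((Real.Gamma a₁ * Real.Gamma a₂ : ℝ) : ℂ) *
        (negMoment (genGammaMeasure a₁ b₁ c₁ ∗ₘ genGammaMeasure a₂ b₂ c₂) s *
          ((z * b₁ * b₂ : ℝ) : ℂ) ^ s) := by
  rw [negMoment_mconv ae_pos_genGammaMeasure ae_pos_genGammaMeasure,
    negMoment_genGammaMeasure ha₁ hb₁ hc₁ h₁, negMoment_genGammaMeasure ha₂ hb₂ hc₂ h₂,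
    Complex.ofReal_mul (z * b₁), Complex.mul_cpow_ofReal_nonneg (by positivity) hb₂.le,
    Complex.ofReal_mul z, Complex.mul_cpow_ofReal_nonneg hz.le hb₁.le, Complex.cpow_neg,
    Complex.cpow_neg]
  have e₁ : (b₁ : ℂ) ^ s ≠ 0 := by
    simp [Complex.cpow_eq_zero_iff, hb₁.ne']
  have e₂ : (b₂ : ℂ) ^ s ≠ 0 := by
    simp [Complex.cpow_eq_zero_iff, hb₂.ne']
  have g₁ : (Real.Gamma a₁ : ℂ) ≠ 0 := by exact_mod_cast (Real.Gamma_pos_of_pos ha₁).ne'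
  have g₂ : (Real.Gamma a₂ : ℂ) ≠ 0 := by exact_mod_cast (Real.Gamma_pos_of_pos ha₂).ne'
  push_cast
  field_simp

variable (ha₁ : 0 < a₁) (hb₁ : 0 < b₁) (hc₁ : 0 < c₁) (ha₂ : 0 < a₂) (hb₂ : 0 < b₂) (hc₂ : 0 < c₂)
  (hz : 0 < z) (hm : σ < m) (h₁ : σ < a₁ * c₁) (h₂ : σ < a₂ * c₂)

include ha₁ hb₁ hc₁ ha₂ hb₂ hc₂ hm h₁ h₂

lemma integrable_logPowKernel_genGamma {x : ℝ} (hx : 0 < x) :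
    Integrable (fun t => logPowKernel m (x / t))
      (genGammaMeasure a₁ b₁ c₁ ∗ₘ genGammaMeasure a₂ b₂ c₂) :=
  integrable_logPowKernel_div ae_pos_genGammaMeasure_mconv hm hx
    (integrable_rpow_genGammaMeasure_mconv ha₁ hb₁ hc₁ ha₂ hb₂ hc₂ h₁ h₂)

lemma integrable_negMoment_genGamma :
    Integrable fun y : ℝ =>
      negMoment (genGammaMeasure a₁ b₁ c₁ ∗ₘ genGammaMeasure a₂ b₂ c₂) (contourPoint σ y) /
        ((m : ℂ) - contourPoint σ y) ^ 2 := by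
  -- At `x = 1` the factor `x^s` disappears.
  simpa using integrable_negMoment_mul_cpow ae_pos_genGammaMeasure_mconv hm one_pos
    (integrable_rpow_genGammaMeasure_mconv (b₁ := b₁) (b₂ := b₂) ha₁ hb₁ hc₁ ha₂ hb₂ hc₂ h₁ h₂)

lemma integral_negMoment_genGamma {x : ℝ} (hx : 0 < x) :
    (1 / (2 * (Real.pi : ℂ))) * ∫ y : ℝ,
      negMoment (genGammaMeasure a₁ b₁ c₁ ∗ₘ genGammaMeasure a₂ b₂ c₂) (contourPoint σ y) /
        ((m : ℂ) - contourPoint σ y) ^ 2 * (x : ℂ) ^ contourPoint σ y =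
      genGammaMixture m a₁ b₁ c₁ a₂ b₂ c₂ x :=
  integral_negMoment_mul_cpow ae_pos_genGammaMeasure_mconv hm hx
    (integrable_rpow_genGammaMeasure_mconv ha₁ hb₁ hc₁ ha₂ hb₂ hc₂ h₁ h₂)

lemma integrableOn_genGammaMixture_div (hσ : 0 < σ) (x : ℝ) :
    IntegrableOn (fun g => genGammaMixture m a₁ b₁ c₁ a₂ b₂ c₂ g / g) (Set.Ioc 0 x) :=
  integrableOn_div_of_mellinBarnes
    (integrable_negMoment_genGamma ha₁ hb₁ hc₁ ha₂ hb₂ hc₂ hm h₁ h₂) hσ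
    fun _ hg => integral_negMoment_genGamma ha₁ hb₁ hc₁ ha₂ hb₂ hc₂ hm h₁ h₂ hg

include hz

lemma mellinBarnes_genGamma :
    Integrable (fun y : ℝ => Complex.Gamma (a₁ - contourPoint σ y / c₁) *
      Complex.Gamma (a₂ - contourPoint σ y / c₂) / ((m : ℂ) - contourPoint σ y) ^ 2 *
        (z : ℂ) ^ contourPoint σ y) ∧
    (1 / (2 * (Real.pi : ℂ))) * ∫ y : ℝ, Complex.Gamma (a₁ - contourPoint σ y / c₁) *
      Complex.Gamma (a₂ - contourPoint σ y / c₂) / ((m : ℂ) - contourPoint σ y) ^ 2 *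
        (z : ℂ) ^ contourPoint σ y =
      ((Real.Gamma a₁ * Real.Gamma a₂ *
        genGammaMixture m a₁ b₁ c₁ a₂ b₂ c₂ (z * b₁ * b₂) : ℝ) : ℂ) := by
  have hx : 0 < z * b₁ * b₂ := by positivity
  have key : ∀ y : ℝ, Complex.Gamma (a₁ - contourPoint σ y / c₁) *
      Complex.Gamma (a₂ - contourPoint σ y / c₂) / ((m : ℂ) - contourPoint σ y) ^ 2 *
        (z : ℂ) ^ contourPoint σ y = ((Real.Gamma a₁ * Real.Gamma a₂ : ℝ) : ℂ) *
      (negMoment (genGammaMeasure a₁ b₁ c₁ ∗ₘ genGammaMeasure a₂ b₂ c₂) (contourPoint σ y) /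
        ((m : ℂ) - contourPoint σ y) ^ 2 * ((z * b₁ * b₂ : ℝ) : ℂ) ^ contourPoint σ y) := by
    intro y
    rw [div_mul_eq_mul_div, Gamma_mul_Gamma_mul_cpow ha₁ hb₁ hc₁ ha₂ hb₂ hc₂ hz
      (by rwa [contourPoint_re]) (by rwa [contourPoint_re])]
    ring
  simp_rw [key]
  refine ⟨(integrable_negMoment_mul_cpow ae_pos_genGammaMeasure_mconv hm hx
    (integrable_rpow_genGammaMeasure_mconv ha₁ hb₁ hc₁ ha₂ hb₂ hc₂ h₁ h₂)).const_mul _, ?_⟩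
  rw [integral_const_mul, mul_left_comm,
    integral_negMoment_genGamma ha₁ hb₁ hc₁ ha₂ hb₂ hc₂ hm h₁ h₂ hx, ← Complex.ofReal_mul]

lemma mellinBarnes_genGamma_div (hσ : 0 < σ) :
    Integrable (fun y : ℝ => Complex.Gamma (a₁ - contourPoint σ y / c₁) *
      Complex.Gamma (a₂ - contourPoint σ y / c₂) / ((m : ℂ) - contourPoint σ y) ^ 2 /
        contourPoint σ y * (z : ℂ) ^ contourPoint σ y) ∧
    (1 / (2 * (Real.pi : ℂ))) * ∫ y : ℝ, Complex.Gamma (a₁ - contourPoint σ y / c₁) *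
      Complex.Gamma (a₂ - contourPoint σ y / c₂) / ((m : ℂ) - contourPoint σ y) ^ 2 /
        contourPoint σ y * (z : ℂ) ^ contourPoint σ y =
      ((Real.Gamma a₁ * Real.Gamma a₂ * ∫ g in Set.Ioc 0 (z * b₁ * b₂),
        genGammaMixture m a₁ b₁ c₁ a₂ b₂ c₂ g / g : ℝ) : ℂ) := by
  have hx : 0 < z * b₁ * b₂ := by positivity
  have key : ∀ y : ℝ, Complex.Gamma (a₁ - contourPoint σ y / c₁) *
      Complex.Gamma (a₂ - contourPoint σ y / c₂) / ((m : ℂ) - contourPoint σ y) ^ 2 /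
        contourPoint σ y * (z : ℂ) ^ contourPoint σ y =
      ((Real.Gamma a₁ * Real.Gamma a₂ : ℝ) : ℂ) *
      (negMoment (genGammaMeasure a₁ b₁ c₁ ∗ₘ genGammaMeasure a₂ b₂ c₂) (contourPoint σ y) /
        ((m : ℂ) - contourPoint σ y) ^ 2 / contourPoint σ y *
          ((z * b₁ * b₂ : ℝ) : ℂ) ^ contourPoint σ y) := by
    intro y
    rw [div_mul_eq_mul_div, div_mul_eq_mul_div, Gamma_mul_Gamma_mul_cpow ha₁ hb₁ hc₁ ha₂ hb₂ hc₂ hz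
      (by rwa [contourPoint_re]) (by rwa [contourPoint_re])]
    ring
  have hΦ := integrable_negMoment_genGamma (b₁ := b₁) (b₂ := b₂) ha₁ hb₁ hc₁ ha₂ hb₂ hc₂ hm h₁ h₂
  simp_rw [key]
  refine ⟨(integrable_mul_cpow_div hΦ hσ hx).const_mul _, ?_⟩
  rw [integral_const_mul, mul_left_comm, integral_div_of_mellinBarnes hΦ hσ hx
    fun _ hg => integral_negMoment_genGamma ha₁ hb₁ hc₁ ha₂ hb₂ hc₂ hm h₁ h₂ hg,
    ← Complex.ofReal_mul]

end Pair

/-! ### Fox functions -/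

/-- This is `Γ(w)/Γ(w+1) = 1/w` for `w = (m-s)/e`; the condition `σ < m` gives `Re w > 0`, hence
`Γ(w) ≠ 0`. -/
lemma Gamma_div_Gamma_add_one_sub {m e σ : ℝ} (he : 0 < e) (hm : σ < m) (y : ℝ) :
    Complex.Gamma (((m / e : ℝ) : ℂ) - ((1 / e : ℝ) : ℂ) * contourPoint σ y) /
      Complex.Gamma (((m / e + 1 : ℝ) : ℂ) - ((1 / e : ℝ) : ℂ) * contourPoint σ y) =
      e / (m - contourPoint σ y) := by
  set w : ℂ := ((m / e : ℝ) : ℂ) - ((1 / e : ℝ) : ℂ) * contourPoint σ y with hw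
  have he' : (e : ℂ) ≠ 0 := by exact_mod_cast he.ne'
  have hwe : w = (m - contourPoint σ y) / e := by
    rw [hw]; push_cast; field_simp
  have hre : 0 < w.re := by
    rw [hwe, Complex.div_ofReal_re]
    simp only [Complex.sub_re, Complex.ofReal_re, contourPoint_re]
    exact div_pos (sub_pos.2 hm) he
  have h0 : w ≠ 0 := fun h => by simp [h] at hre
  have hG : Complex.Gamma w ≠ 0 := Complex.Gamma_ne_zero_of_re_pos hre
  have : ((m / e + 1 : ℝ) : ℂ) - ((1 / e : ℝ) : ℂ) * contourPoint σ y = w + 1 := by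
    rw [hw]; push_cast; ring
  rw [this, Complex.Gamma_add_one _ h0, hwe, div_mul_cancel_right₀ (by rwa [← hwe]), inv_div]

/-- The same quotient with `w = s/d`, kept in the form that the parameters `(1, 1/d)` and `(0, 1/d)`
produce in the kernel. -/
lemma Gamma_div_Gamma_one_add {d σ : ℝ} (hd : 0 < d) (hσ : 0 < σ) (y : ℝ) :
    Complex.Gamma (1 - ((1 : ℝ) : ℂ) + ((1 / d : ℝ) : ℂ) * contourPoint σ y) /
      Complex.Gamma (1 - ((0 : ℝ) : ℂ) + ((1 / d : ℝ) : ℂ) * contourPoint σ y) =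
      d / contourPoint σ y := by
  set w : ℂ := ((1 / d : ℝ) : ℂ) * contourPoint σ y with hw
  have hre : 0 < w.re := by
    rw [hw, Complex.re_ofReal_mul, contourPoint_re]
    positivity
  have h0 : w ≠ 0 := fun h => by simp [h] at hre
  have hG : Complex.Gamma w ≠ 0 := Complex.Gamma_ne_zero_of_re_pos hre
  have e1 : 1 - ((1 : ℝ) : ℂ) + w = w := by push_cast; ring
  have e2 : 1 - ((0 : ℝ) : ℂ) + w = w + 1 := by push_cast; ring
  rw [e1, e2, Complex.Gamma_add_one _ h0, div_mul_cancel_right₀ hG, hw, mul_inv]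
  push_cast
  rw [one_div, inv_inv]
  rfl

section Fox

variable {m a₁ b₁ c₁ a₂ b₂ c₂ e d z : ℝ}

/-- Lower bound of a family of poles. -/
lemma lt_add_div_one_div {a c σ : ℝ} (hc : 0 < c) (h : σ < a * c) (k : ℕ) :
    σ < (a + k) / (1 / c) := by
  rw [div_div_eq_mul_div, div_one]
  refine h.trans_le ?_
  gcongr
  simp

lemma lt_mul_of_forall {a c σ : ℝ} (h : ∀ k : ℕ, σ < (a + k) / (1 / c)) : σ < a * c := by
  simpa [div_div_eq_mul_div] using h 0

/-- In each family the pole with `k = 0` is the leftmost, so it alone constrains the line. -/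
lemma separatesPoles_four_zero_iff (hc₁ : 0 < c₁) (hc₂ : 0 < c₂) (he : 0 < e) (as : List (ℝ × ℝ))
    (σ : ℝ) :
    SeparatesPoles 4 0 as [(a₁, 1 / c₁), (m / e, 1 / e), (a₂, 1 / c₂), (m / e, 1 / e)] σ ↔
      σ < m ∧ σ < a₁ * c₁ ∧ σ < a₂ * c₂ := by
  have hme : m / e * e = m := div_mul_cancel₀ _ he.ne'
  simp only [SeparatesPoles, List.take, List.forall_mem_cons, List.not_mem_nil, false_imp_iff,
    implies_true, and_true]
  refine ⟨fun ⟨h1, h2, h3, _⟩ =>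
    ⟨hme ▸ lt_mul_of_forall h2, lt_mul_of_forall h1, lt_mul_of_forall h3⟩, fun ⟨h1, h2, h3⟩ => ?_⟩
  have h1' := fun k => lt_add_div_one_div he (hme.symm ▸ h1) k
  exact ⟨lt_add_div_one_div hc₁ h2, h1', lt_add_div_one_div hc₂ h3, h1'⟩

/-- The additional factor `Γ(s/d)` has its poles at `-k d`, the rightmost being 0. -/
lemma separatesPoles_four_one_iff (hc₁ : 0 < c₁) (hc₂ : 0 < c₂) (he : 0 < e) (hd : 0 < d)
    (as bs : List (ℝ × ℝ)) (σ : ℝ) :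
    SeparatesPoles 4 1 ((1, 1 / d) :: as)
      ([(a₁, 1 / c₁), (m / e, 1 / e), (a₂, 1 / c₂), (m / e, 1 / e)] ++ bs) σ ↔
      (σ < m ∧ σ < a₁ * c₁ ∧ σ < a₂ * c₂) ∧ 0 < σ := by
  rw [← separatesPoles_four_zero_iff hc₁ hc₂ he as]
  simp only [SeparatesPoles, List.take, List.forall_mem_cons, List.not_mem_nil, false_imp_iff,
    implies_true, and_true, List.cons_append, sub_self, zero_sub]
  refine and_congr_right fun _ => ⟨fun h => by simpa using h 0, fun h k => ?_⟩
  rw [div_div_eq_mul_div, div_one]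
  have : 0 ≤ (k : ℝ) * d := by positivity
  linarith

variable (ha₁ : 0 < a₁) (hb₁ : 0 < b₁) (hc₁ : 0 < c₁) (ha₂ : 0 < a₂) (hb₂ : 0 < b₂) (hc₂ : 0 < c₂)
  (hm : 0 < m) (he : 0 < e) (hd : 0 < d) (hz : 0 < z)

include ha₁ hc₁ ha₂ hc₂ hm in
lemma exists_pos_contour : ∃ σ : ℝ, (σ < m ∧ σ < a₁ * c₁ ∧ σ < a₂ * c₂) ∧ 0 < σ := by
  obtain ⟨σ, h0, h⟩ := exists_between
    (lt_min hm (lt_min (mul_pos ha₁ hc₁) (mul_pos ha₂ hc₂)))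
  rw [lt_min_iff, lt_min_iff] at h
  exact ⟨σ, h, h0⟩

include ha₁ hb₁ hc₁ ha₂ hb₂ hc₂ hm he hz

/-- The free parameter `e` lets one statement cover all three terms: `e = 1` for the exponential
pair, `e = c` for the two others. -/
lemma isFoxH_four_zero :
    IsFoxH 4 0 [(m / e + 1, 1 / e), (m / e + 1, 1 / e)]
      [(a₁, 1 / c₁), (m / e, 1 / e), (a₂, 1 / c₂), (m / e, 1 / e)] z
      ((e ^ 2 * (Real.Gamma a₁ * Real.Gamma a₂ *
        genGammaMixture m a₁ b₁ c₁ a₂ b₂ c₂ (z * b₁ * b₂)) : ℝ) : ℂ) := by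
  refine ⟨?_, fun σ hσ => ?_⟩
  · obtain ⟨σ, h, -⟩ := exists_pos_contour ha₁ hc₁ ha₂ hc₂ hm
    exact ⟨σ, (separatesPoles_four_zero_iff hc₁ hc₂ he _ _).2 h⟩
  rw [separatesPoles_four_zero_iff hc₁ hc₂ he] at hσ
  obtain ⟨h, h₁, h₂⟩ := hσ
  have key : ∀ y : ℝ, foxHKernel 4 0 [(m / e + 1, 1 / e), (m / e + 1, 1 / e)]
      [(a₁, 1 / c₁), (m / e, 1 / e), (a₂, 1 / c₂), (m / e, 1 / e)] (contourPoint σ y) *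
        (z : ℂ) ^ contourPoint σ y = ((e ^ 2 : ℝ) : ℂ) *
      (Complex.Gamma (a₁ - contourPoint σ y / c₁) *
      Complex.Gamma (a₂ - contourPoint σ y / c₂) / ((m : ℂ) - contourPoint σ y) ^ 2 *
        (z : ℂ) ^ contourPoint σ y) := by
    intro y
    have hg := Gamma_div_Gamma_add_one_sub he h y
    have e₁ : ∀ c : ℝ, ((1 / c : ℝ) : ℂ) * contourPoint σ y = contourPoint σ y / c := fun c => by
      push_cast; ring
    simp only [foxHKernel, List.take, List.drop, List.map_cons, List.map_nil, List.prod_cons,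
      List.prod_nil, mul_one, one_mul]
    rw [e₁ c₁, e₁ c₂]
    set G := Complex.Gamma (((m / e : ℝ) : ℂ) - ((1 / e : ℝ) : ℂ) * contourPoint σ y)
    set G' := Complex.Gamma (((m / e + 1 : ℝ) : ℂ) - ((1 / e : ℝ) : ℂ) * contourPoint σ y)
    calc _ = Complex.Gamma (a₁ - contourPoint σ y / c₁) * Complex.Gamma (a₂ - contourPoint σ y / c₂)
          * (G / G') ^ 2 * (z : ℂ) ^ contourPoint σ y := by ring
      _ = _ := by rw [hg, div_pow]; push_cast; ring
  obtain ⟨hi, hv⟩ := mellinBarnes_genGamma ha₁ hb₁ hc₁ ha₂ hb₂ hc₂ hz h h₁ h₂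
  simp_rw [key]
  refine ⟨hi.const_mul _, ?_⟩
  rw [integral_const_mul, mul_left_comm, hv, ← Complex.ofReal_mul]

include hd

lemma isFoxH_four_one :
    IsFoxH 4 1 [(1, 1 / d), (m / e + 1, 1 / e), (m / e + 1, 1 / e)]
      [(a₁, 1 / c₁), (m / e, 1 / e), (a₂, 1 / c₂), (m / e, 1 / e), (0, 1 / d)] z
      ((e ^ 2 * d * (Real.Gamma a₁ * Real.Gamma a₂ * ∫ g in Set.Ioc 0 (z * b₁ * b₂),
        genGammaMixture m a₁ b₁ c₁ a₂ b₂ c₂ g / g) : ℝ) : ℂ) := by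
  refine ⟨?_, fun σ hσ => ?_⟩
  · obtain ⟨σ, h⟩ := exists_pos_contour ha₁ hc₁ ha₂ hc₂ hm
    exact ⟨σ, (separatesPoles_four_one_iff hc₁ hc₂ he hd _ [(0, 1 / d)] _).2 h⟩
  have hσ' := (separatesPoles_four_one_iff hc₁ hc₂ he hd _ [(0, 1 / d)] _).1 hσ
  obtain ⟨⟨h, h₁, h₂⟩, h0⟩ := hσ'
  have key : ∀ y : ℝ, foxHKernel 4 1 [(1, 1 / d), (m / e + 1, 1 / e), (m / e + 1, 1 / e)]
      [(a₁, 1 / c₁), (m / e, 1 / e), (a₂, 1 / c₂), (m / e, 1 / e), (0, 1 / d)]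
        (contourPoint σ y) *
        (z : ℂ) ^ contourPoint σ y = ((e ^ 2 * d : ℝ) : ℂ) *
      (Complex.Gamma (a₁ - contourPoint σ y / c₁) *
      Complex.Gamma (a₂ - contourPoint σ y / c₂) / ((m : ℂ) - contourPoint σ y) ^ 2 /
        contourPoint σ y * (z : ℂ) ^ contourPoint σ y) := by
    intro y
    have hg := Gamma_div_Gamma_add_one_sub he h y
    have hg1 := Gamma_div_Gamma_one_add hd h0 y
    have e₁ : ∀ c : ℝ, ((1 / c : ℝ) : ℂ) * contourPoint σ y = contourPoint σ y / c := fun c => by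
      push_cast; ring
    simp only [foxHKernel, List.take, List.drop, List.map_cons, List.map_nil, List.prod_cons,
      List.prod_nil, mul_one]
    rw [e₁ c₁, e₁ c₂]
    set G := Complex.Gamma (((m / e : ℝ) : ℂ) - ((1 / e : ℝ) : ℂ) * contourPoint σ y)
    set G' := Complex.Gamma (((m / e + 1 : ℝ) : ℂ) - ((1 / e : ℝ) : ℂ) * contourPoint σ y)
    set D := Complex.Gamma (1 - ((1 : ℝ) : ℂ) + ((1 / d : ℝ) : ℂ) * contourPoint σ y)
    set D' := Complex.Gamma (1 - ((0 : ℝ) : ℂ) + ((1 / d : ℝ) : ℂ) * contourPoint σ y)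
    calc _ = Complex.Gamma (a₁ - contourPoint σ y / c₁) * Complex.Gamma (a₂ - contourPoint σ y / c₂)
          * (G / G') ^ 2 * (D / D') * (z : ℂ) ^ contourPoint σ y := by ring
      _ = _ := by rw [hg, hg1, div_pow]; push_cast; ring
  obtain ⟨hi, hv⟩ := mellinBarnes_genGamma_div ha₁ hb₁ hc₁ ha₂ hb₂ hc₂ hz h h₁ h₂ h0
  simp_rw [key]
  refine ⟨hi.const_mul _, ?_⟩
  rw [integral_const_mul, mul_left_comm, hv, ← Complex.ofReal_mul]

end Fox

/-- Rescaling of the integration variable in a Mellin-Barnes integral. -/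
lemma IsFoxH.rescale {m n : ℕ} {as bs : List (ℝ × ℝ)} {z c : ℝ} {w : ℂ} (hc : 0 < c) (hz : 0 < z)
    (h : IsFoxH m n as bs z w) :
    IsFoxH m n (as.map fun p => (p.1, p.2 * c)) (bs.map fun p => (p.1, p.2 * c))
      ((z ^ c : ℝ) : ℂ) (w / c) := by
  have hsep : ∀ σ : ℝ, SeparatesPoles m n (as.map fun p => (p.1, p.2 * c))
      (bs.map fun p => (p.1, p.2 * c)) σ ↔ SeparatesPoles m n as bs (c * σ) := by
    intro σ
    simp only [SeparatesPoles, ← List.map_take, List.forall_mem_map, ← div_div, lt_div_iff₀ hc,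
      div_lt_iff₀ hc, mul_comm σ c]
  have hpt : ∀ σ y : ℝ, contourPoint (c * σ) (c * y) = c * contourPoint σ y := by
    intro σ y
    simp only [contourPoint]
    push_cast
    ring
  have hker : ∀ σ y : ℝ, foxHKernel m n (as.map fun p => (p.1, p.2 * c))
      (bs.map fun p => (p.1, p.2 * c)) (contourPoint σ y) *
        ((z ^ c : ℝ) : ℂ) ^ contourPoint σ y =
      foxHKernel m n as bs (contourPoint (c * σ) (c * y)) *
        (z : ℂ) ^ contourPoint (c * σ) (c * y) := by
    intro σ y
    rw [hpt, Complex.cpow_mul_ofReal_nonneg hz.le]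
    simp only [foxHKernel, ← List.map_take, ← List.map_drop, List.map_map, Function.comp_def,
      Complex.ofReal_mul, mul_assoc]
  refine ⟨?_, fun σ hσ => ?_⟩
  · obtain ⟨σ, hσ⟩ := h.1
    refine ⟨c⁻¹ * σ, (hsep _).2 ?_⟩
    rwa [mul_inv_cancel_left₀ hc.ne']
  · obtain ⟨hi, hv⟩ := h.2 _ ((hsep σ).1 hσ)
    simp_rw [hker]
    refine ⟨hi.comp_mul_left' hc.ne', ?_⟩
    rw [Measure.integral_comp_mul_left (fun y => foxHKernel m n as bs (contourPoint (c * σ) y) *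
      (z : ℂ) ^ contourPoint (c * σ) y), ← hv, abs_of_pos (inv_pos.2 hc), Complex.real_smul]
    push_cast
    ring

/-! ### The law of the pointing loss -/

lemma gammaPDF_one (r : ℝ) {x : ℝ} (hx : 0 ≤ x) :
    gammaPDF 1 r x = ENNReal.ofReal (r * Real.exp (-(r * x))) := by
  rw [gammaPDF_of_nonneg hx]; simp

lemma gammaPDF_two (r : ℝ) {x : ℝ} (hx : 0 ≤ x) :
    gammaPDF 2 r x = ENNReal.ofReal (r ^ 2 * x * Real.exp (-(r * x))) := by
  rw [gammaPDF_of_nonneg hx]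
  have h1 : Real.Gamma 2 = 1 := by simp
  have h2 : (2 : ℝ) - 1 = 1 := by norm_num
  rw [h1, h2]
  norm_num

lemma measurable_gammaPDF (a r : ℝ) : Measurable (gammaPDF a r) :=
  (measurable_gammaPDFReal a r).ennreal_ofReal

/-- The squared norm of a centred isotropic planar Gaussian vector is exponential. -/
lemma map_sq_add_sq_gaussianReal {σ κ : ℝ} (hσ : 0 < σ) (hκ : 0 < κ) :
    ((gaussianReal 0 (Real.toNNReal (σ ^ 2))).prod (gaussianReal 0 (Real.toNNReal (σ ^ 2)))).map
      (fun p : ℝ × ℝ => κ * (p.1 ^ 2 + p.2 ^ 2)) = gammaMeasure 1 (1 / (2 * σ ^ 2 * κ)) := by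
  have hv : Real.toNNReal (σ ^ 2) ≠ 0 := by
    rw [Ne, Real.toNNReal_eq_zero, not_le]; positivity
  have hmeas : Measurable (fun p : ℝ × ℝ => κ * (p.1 ^ 2 + p.2 ^ 2)) := by fun_prop
  refine Measure.ext_of_lintegral _ fun g hg => ?_
  rw [lintegral_map hg hmeas, gaussianReal_of_var_ne_zero _ hv,
    prod_withDensity (by fun_prop) (by fun_prop),
    lintegral_withDensity_eq_lintegral_mul _ (by fun_prop)
      (show Measurable fun p : ℝ × ℝ => g (κ * (p.1 ^ 2 + p.2 ^ 2)) from hg.comp hmeas)]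
  -- In polar coordinates the integrand does not depend on the angle, which then contributes only a
  -- factor `2π`; the substitution `u = κ r²` finishes.
  rw [← Measure.volume_eq_prod, ← lintegral_comp_polarCoord_symm]
  have hpdf : ∀ p ∈ polarCoord.target, ENNReal.ofReal p.1 •
      (((fun z : ℝ × ℝ => gaussianPDF 0 (Real.toNNReal (σ ^ 2)) z.1 *
        gaussianPDF 0 (Real.toNNReal (σ ^ 2)) z.2) *
        fun z : ℝ × ℝ => g (κ * (z.1 ^ 2 + z.2 ^ 2))) (polarCoord.symm p)) =
      ENNReal.ofReal (p.1 * ((2 * Real.pi * σ ^ 2)⁻¹ * Real.exp (-p.1 ^ 2 / (2 * σ ^ 2)))) *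
        g (κ * p.1 ^ 2) := by
    intro p hp
    have hp1 : (0 : ℝ) < p.1 := by
      rw [polarCoord_target] at hp
      exact hp.1
    have hsq : (p.1 * Real.cos p.2) ^ 2 + (p.1 * Real.sin p.2) ^ 2 = p.1 ^ 2 := by
      nlinarith [Real.sin_sq_add_cos_sq p.2]
    simp only [Pi.mul_apply, polarCoord_symm_apply, smul_eq_mul, hsq, gaussianPDF,
      gaussianPDFReal, sub_zero]
    rw [← ENNReal.ofReal_mul (by positivity), ← mul_assoc, ← ENNReal.ofReal_mul hp1.le,
      Real.coe_toNNReal _ (by positivity)]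
    congr 3
    have hs : Real.sqrt (2 * Real.pi * σ ^ 2) * Real.sqrt (2 * Real.pi * σ ^ 2) =
        2 * Real.pi * σ ^ 2 := Real.mul_self_sqrt (by positivity)
    calc _ = (Real.sqrt (2 * Real.pi * σ ^ 2) * Real.sqrt (2 * Real.pi * σ ^ 2))⁻¹ *
          (Real.exp (-(p.1 * Real.cos p.2) ^ 2 / (2 * σ ^ 2)) *
            Real.exp (-(p.1 * Real.sin p.2) ^ 2 / (2 * σ ^ 2))) := by
          rw [mul_inv]; ring
      _ = _ := by
          rw [hs, ← Real.exp_add, ← hsq]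
          congr 2
          ring
  rw [setLIntegral_congr_fun polarCoord.open_target.measurableSet hpdf, polarCoord_target,
    Measure.volume_eq_prod, ← Measure.prod_restrict, lintegral_prod _ (by fun_prop)]
  simp only [lintegral_const, Measure.restrict_apply, MeasurableSet.univ, Set.univ_inter,
    Real.volume_Ioo]
  have himg : (fun r : ℝ => κ * r ^ 2) '' Set.Ioi 0 = Set.Ioi 0 := by
    ext u
    constructor
    · rintro ⟨r, hr, rfl⟩
      have : (0 : ℝ) < r := hr
      exact Set.mem_Ioi.2 (by positivity)
    · intro hu
      have hu' : (0 : ℝ) < u := hu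
      refine ⟨Real.sqrt (u / κ), Real.sqrt_pos.2 (by positivity), ?_⟩
      simp only
      rw [Real.sq_sqrt (by positivity)]
      field_simp
  have hinj : Set.InjOn (fun r : ℝ => κ * r ^ 2) (Set.Ioi 0) := by
    intro r hr s hs h
    have h' : r ^ 2 = s ^ 2 := mul_left_cancel₀ hκ.ne' h
    exact (pow_left_inj₀ (le_of_lt hr) (le_of_lt hs) two_ne_zero).1 h'
  have hder : ∀ r ∈ Set.Ioi (0 : ℝ), HasDerivWithinAt (fun r : ℝ => κ * r ^ 2) (2 * κ * r)
      (Set.Ioi 0) r := by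
    intro r _
    have h : HasDerivAt (fun r : ℝ => κ * r ^ 2) (κ * (2 * r)) r := by
      simpa using (hasDerivAt_pow 2 r).const_mul κ
    exact (h.congr_deriv (by ring)).hasDerivWithinAt
  have hR : ∫⁻ u, g u ∂gammaMeasure 1 (1 / (2 * σ ^ 2 * κ)) = ∫⁻ u in Set.Ioi 0,
      ENNReal.ofReal (1 / (2 * σ ^ 2 * κ) * Real.exp (-(1 / (2 * σ ^ 2 * κ) * u))) * g u := by
    rw [gammaMeasure, lintegral_withDensity_eq_lintegral_mul _ (measurable_gammaPDF _ _) hg,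
      ← lintegral_indicator measurableSet_Ioi]
    refine lintegral_congr_ae ?_
    -- At 0 the exponential density is positive while the indicator vanishes; this null point is
    -- discarded.
    filter_upwards [compl_mem_ae_iff.2 (measure_singleton (0 : ℝ))] with u hu
    rcases lt_trichotomy u 0 with h | h | h
    · rw [Set.indicator_of_notMem (by simpa using h.le), Pi.mul_apply, gammaPDF_of_neg h, zero_mul]
    · exact absurd h hu
    · rw [Set.indicator_of_mem (by simpa using h), Pi.mul_apply, gammaPDF_one _ h.le]
  rw [hR]
  conv_rhs => rw [← himg, lintegral_image_eq_lintegral_abs_deriv_mul measurableSet_Ioi hder hinj]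
  refine setLIntegral_congr_fun measurableSet_Ioi fun r hr => ?_
  have hr' : (0 : ℝ) < r := hr
  have hpi := Real.pi_pos
  rw [mul_right_comm, ← ENNReal.ofReal_mul (by positivity),
    ← mul_assoc (ENNReal.ofReal |2 * κ * r|), ← ENNReal.ofReal_mul (abs_nonneg _),
    abs_of_pos (by positivity : 0 < 2 * κ * r)]
  congr 2
  have : -(1 / (2 * σ ^ 2 * κ) * (κ * r ^ 2)) = -r ^ 2 / (2 * σ ^ 2) := by field_simp
  rw [this]
  field_simp
  ring

/-- The product of the two densities is the constant `r² exp(-r x)` on `[0, x]`, an interval of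
length `x`. -/
lemma gammaMeasure_one_conv_self {r : ℝ} (hr : 0 < r) :
    gammaMeasure 1 r ∗ gammaMeasure 1 r = gammaMeasure 2 r := by
  rw [gammaMeasure, gammaMeasure, conv_withDensity_eq_lconvolution
    (measurable_gammaPDF _ _) (measurable_gammaPDF _ _)]
  congr 1
  ext x
  rw [lconvolution_def]
  rcases lt_or_ge x 0 with hx | hx
  · rw [gammaPDF_of_neg hx]
    refine (lintegral_congr fun y => ?_).trans lintegral_zero
    rcases lt_or_ge y 0 with hy | hy
    · rw [gammaPDF_of_neg hy, zero_mul]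
    · rw [gammaPDF_of_neg (x := -y + x) (by linarith), mul_zero]
  · have h : ∀ y, gammaPDF 1 r y * gammaPDF 1 r (-y + x) =
        (Set.Icc 0 x).indicator (fun _ => ENNReal.ofReal (r ^ 2 * Real.exp (-(r * x)))) y := by
      intro y
      rcases lt_or_ge y 0 with hy | hy
      · rw [gammaPDF_of_neg hy, zero_mul, Set.indicator_of_notMem (fun h => by linarith [h.1])]
      rcases lt_or_ge x y with hy' | hy'
      · rw [gammaPDF_of_neg (x := -y + x) (by linarith), mul_zero,
          Set.indicator_of_notMem (fun h => by linarith [h.2])]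
      rw [Set.indicator_of_mem (show y ∈ Set.Icc 0 x from ⟨hy, hy'⟩), gammaPDF_one _ hy,
        gammaPDF_one _ (by linarith), ← ENNReal.ofReal_mul (by positivity)]
      congr 1
      rw [mul_mul_mul_comm, ← Real.exp_add, ← sq]
      congr 2
      ring
    simp_rw [h]
    rw [lintegral_indicator measurableSet_Icc, setLIntegral_const, Real.volume_Icc,
      gammaPDF_two _ hx, ← ENNReal.ofReal_mul (by positivity)]
    congr 1
    ring

/-- Products of pointing losses thereby become sums of exponential variables. -/
lemma map_exp_neg_mconv {μ ν : Measure ℝ} [SFinite μ] [SFinite ν] :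
    μ.map (fun x => Real.exp (-x)) ∗ₘ ν.map (fun x => Real.exp (-x)) =
      (μ ∗ ν).map (fun x => Real.exp (-x)) := by
  rw [Measure.mconv, Measure.conv, Measure.map_prod_map _ _ (by fun_prop) (by fun_prop),
    Measure.map_map (by fun_prop) (by fun_prop), Measure.map_map (by fun_prop) (by fun_prop)]
  congr 1
  ext p
  simp [Real.exp_add, mul_comm]

/-! ### Density of a multiplicative mixture -/

/-- Substitution `y = T exp(-x)` over the whole line. The truncation `max (-log u) 0` matches the
vanishing of the Gamma density at `x < 0`. -/
lemma lintegral_mul_exp_neg_gammaMeasure_two {m T : ℝ} (hT : 0 < T) {g : ℝ → ENNReal}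
    (hg : Measurable g) :
    ∫⁻ x, g (T * Real.exp (-x)) ∂gammaMeasure 2 m =
      ∫⁻ y in Set.Ioi 0, ENNReal.ofReal (m ^ 2 / y * logPowKernel m (y / T)) * g y := by
  have himg : (fun x : ℝ => T * Real.exp (-x)) '' Set.univ = Set.Ioi 0 := by
    ext y
    constructor
    · rintro ⟨x, -, rfl⟩
      exact Set.mem_Ioi.2 (by positivity)
    · intro hy
      have hy' : (0 : ℝ) < y := hy
      refine ⟨-Real.log (y / T), trivial, ?_⟩
      simp only [neg_neg]
      rw [Real.exp_log (by positivity)]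
      field_simp
  have hinj : Set.InjOn (fun x : ℝ => T * Real.exp (-x)) Set.univ := by
    intro x _ y _ h
    exact neg_injective (Real.exp_injective (mul_left_cancel₀ hT.ne' h))
  have hder : ∀ x ∈ (Set.univ : Set ℝ), HasDerivWithinAt (fun x : ℝ => T * Real.exp (-x))
      (T * -Real.exp (-x)) Set.univ x := by
    intro x _
    have := (((Real.hasDerivAt_exp (-x)).comp x (hasDerivAt_neg x)).const_mul T).hasDerivWithinAt
      (s := Set.univ)
    simpa using this
  rw [gammaMeasure, lintegral_withDensity_eq_lintegral_mul _ (measurable_gammaPDF _ _)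
    (show Measurable fun x => g (T * Real.exp (-x)) by fun_prop), ← himg,
    lintegral_image_eq_lintegral_abs_deriv_mul MeasurableSet.univ hder hinj, setLIntegral_univ]
  refine lintegral_congr fun x => ?_
  rw [Pi.mul_apply, ← mul_assoc, ← ENNReal.ofReal_mul (abs_nonneg _)]
  congr 1
  have habs : |T * -Real.exp (-x)| = T * Real.exp (-x) := by
    rw [mul_neg, abs_neg, abs_of_pos (by positivity)]
  have hlog : logPowKernel m (T * Real.exp (-x) / T) = max x 0 * Real.exp (-(m * x)) := by
    rw [mul_div_cancel_left₀ _ hT.ne', logPowKernel, Real.log_exp, neg_neg, ← Real.exp_mul]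
    congr 2
    ring
  rw [habs, hlog]
  have : T * Real.exp (-x) * (m ^ 2 / (T * Real.exp (-x)) * (max x 0 * Real.exp (-(m * x)))) =
      m ^ 2 * max x 0 * Real.exp (-(m * x)) := by
    field_simp
  rw [this]
  rcases lt_or_ge x 0 with hx | hx
  · rw [gammaPDF_of_neg hx, max_eq_right hx.le]
    simp
  · rw [gammaPDF_two _ hx, max_eq_left hx]

/-- The density of `K T Z` where `T` has law `ν` and `-log Z` has a Gamma law with shape `2`
and rate `m`. -/
def mixtureDensity (m K : ℝ) (ν : Measure ℝ) (y : ℝ) : ℝ :=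
  if 0 < y then m ^ 2 / y * ∫ t, logPowKernel m (y / K / t) ∂ν else 0

lemma measurable_mixtureDensity (m K : ℝ) (ν : Measure ℝ) [SFinite ν] :
    Measurable (mixtureDensity m K ν) := by
  unfold mixtureDensity
  refine Measurable.ite measurableSet_Ioi ?_ measurable_const
  refine Measurable.mul (by fun_prop) ?_
  refine (StronglyMeasurable.integral_prod_right (f := fun y t => logPowKernel m (y / K / t))
    ?_).measurable
  refine Measurable.stronglyMeasurable ?_
  have := measurable_logPowKernel m
  exact this.comp (by fun_prop)

lemma mixtureDensity_nonneg {m K : ℝ} {ν : Measure ℝ} (hK : 0 < K) (hν : ∀ᵐ t ∂ν, 0 < t) (y : ℝ) :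
    0 ≤ mixtureDensity m K ν y := by
  unfold mixtureDensity
  split_ifs with hy
  · refine mul_nonneg (by positivity) (integral_nonneg_of_ae ?_)
    filter_upwards [hν] with t ht
    exact logPowKernel_nonneg _ (by positivity)
  · exact le_rfl

/-- Conditioning on `T`, then Tonelli. Integrability of the kernel identifies the resulting Lebesgue
integral with the real-valued one in `mixtureDensity`, which would otherwise default to 0. -/
lemma map_mul_mconv_eq_withDensity {m K : ℝ} {ν : Measure ℝ} [SFinite ν] (hm : 0 < m) (hK : 0 < K)
    (hν : ∀ᵐ t ∂ν, 0 < t)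
    (hint : ∀ x, 0 < x → Integrable (fun t => logPowKernel m (x / t)) ν) :
    (ν ∗ₘ (gammaMeasure 2 m).map fun x => Real.exp (-x)).map (fun x => K * x) =
      volume.withDensity fun y => ENNReal.ofReal (mixtureDensity m K ν y) := by
  have := isProbabilityMeasure_gammaMeasure two_pos hm
  have hker := measurable_logPowKernel m
  refine Measure.ext_of_lintegral _ fun g hg => ?_
  rw [lintegral_map hg (by fun_prop),
    Measure.lintegral_mconv (show Measurable fun x => g (K * x) by fun_prop),
    lintegral_withDensity_eq_lintegral_mul _ (measurable_mixtureDensity m K ν).ennreal_ofReal hg]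
  have h1 : ∀ᵐ t ∂ν, ∫⁻ y, g (K * (t * y)) ∂(gammaMeasure 2 m).map (fun x => Real.exp (-x)) =
      ∫⁻ y in Set.Ioi 0, ENNReal.ofReal (m ^ 2 / y * logPowKernel m (y / (K * t))) * g y := by
    filter_upwards [hν] with t ht
    rw [lintegral_map (show Measurable fun y => g (K * (t * y)) by fun_prop) (by fun_prop),
      ← lintegral_mul_exp_neg_gammaMeasure_two (mul_pos hK ht) hg]
    simp_rw [mul_assoc]
  rw [lintegral_congr_ae h1, lintegral_lintegral_swap, ← lintegral_indicator measurableSet_Ioi]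
  · refine lintegral_congr fun y => ?_
    by_cases hy : 0 < y
    · rw [Set.indicator_of_mem (show y ∈ Set.Ioi (0 : ℝ) from hy), Pi.mul_apply,
        lintegral_mul_const _ (by fun_prop), mixtureDensity, if_pos hy, ← integral_const_mul,
        ofReal_integral_eq_lintegral_ofReal ((hint _ (div_pos hy hK)).const_mul _)]
      · simp_rw [div_div]
      · filter_upwards [hν] with t ht
        exact mul_nonneg (by positivity) (logPowKernel_nonneg _ (by positivity))
    · rw [Set.indicator_of_notMem (show y ∉ Set.Ioi (0 : ℝ) from hy), Pi.mul_apply,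
        mixtureDensity, if_neg hy]
      simp
  · refine Measurable.aemeasurable ?_
    refine Measurable.mul ?_ (hg.comp measurable_snd)
    refine Measurable.ennreal_ofReal ?_
    exact Measurable.mul (by fun_prop) (hker.comp (by fun_prop))

/-- Regroups `(T₁Z₁)(T₂Z₂)` as `(T₁T₂)(Z₁Z₂)`. -/
lemma mconv_mconv_mconv_comm {μ ν : Measure ℝ} [SFinite μ] [SFinite ν] :
    (μ ∗ₘ ν) ∗ₘ (μ ∗ₘ ν) = (μ ∗ₘ μ) ∗ₘ (ν ∗ₘ ν) := by
  rw [Measure.mconv_assoc, ← Measure.mconv_assoc ν, Measure.mconv_comm ν μ, Measure.mconv_assoc μ ν,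
    Measure.mconv_assoc μ μ]

/-! ### The optical link -/

lemma erf_pos {x : ℝ} (hx : 0 < x) : 0 < erf x := by
  unfold erf
  have hpi := Real.pi_pos
  refine mul_pos (by positivity) ?_
  exact intervalIntegral.intervalIntegral_pos_of_pos
    ((by fun_prop : Continuous fun t : ℝ => Real.exp (-t ^ 2)).intervalIntegrable _ _)
    (fun t => Real.exp_pos _) hx

/-- Mixtures of two laws on the half-line: the multiplicative square. -/
lemma integral_mixture_mconv_self {μ ν : Measure ℝ} [SFinite μ] [SFinite ν] {p : ℝ}
    (hp : p ∈ Set.Icc (0 : ℝ) 1) {φ : ℝ → ℝ} (h₁ : Integrable φ (μ ∗ₘ μ))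
    (h₂ : Integrable φ (ν ∗ₘ μ)) (h₃ : Integrable φ (ν ∗ₘ ν)) :
    Integrable φ ((ENNReal.ofReal p • μ + ENNReal.ofReal (1 - p) • ν) ∗ₘ
      (ENNReal.ofReal p • μ + ENNReal.ofReal (1 - p) • ν)) ∧
    ∫ t, φ t ∂((ENNReal.ofReal p • μ + ENNReal.ofReal (1 - p) • ν) ∗ₘ
      (ENNReal.ofReal p • μ + ENNReal.ofReal (1 - p) • ν)) =
      p ^ 2 * ∫ t, φ t ∂(μ ∗ₘ μ) + 2 * p * (1 - p) * ∫ t, φ t ∂(ν ∗ₘ μ) +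
        (1 - p) ^ 2 * ∫ t, φ t ∂(ν ∗ₘ ν) := by
  have hq : 0 ≤ 1 - p := sub_nonneg.2 hp.2
  rw [Measure.mconv_add, Measure.add_mconv, Measure.add_mconv]
  simp only [Measure.mconv_smul_left, Measure.mconv_smul_right]
  -- Both cross terms now involve the same product law, whence the coefficient `2 p (1 - p)`.
  rw [Measure.mconv_comm μ ν]
  have i₁ := (h₁.smul_measure (ENNReal.ofReal_ne_top (r := p))).smul_measure
    (ENNReal.ofReal_ne_top (r := p))
  have i₂ := (h₂.smul_measure (ENNReal.ofReal_ne_top (r := 1 - p))).smul_measure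
    (ENNReal.ofReal_ne_top (r := p))
  have i₂' := (h₂.smul_measure (ENNReal.ofReal_ne_top (r := p))).smul_measure
    (ENNReal.ofReal_ne_top (r := 1 - p))
  have i₃ := (h₃.smul_measure (ENNReal.ofReal_ne_top (r := 1 - p))).smul_measure
    (ENNReal.ofReal_ne_top (r := 1 - p))
  simp only [smul_comm (ENNReal.ofReal (1 - p)) (ENNReal.ofReal p)] at i₂' ⊢
  refine ⟨(i₁.add_measure i₂').add_measure (i₂.add_measure i₃), ?_⟩
  rw [integral_add_measure (i₁.add_measure i₂') (i₂.add_measure i₃),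
    integral_add_measure i₁ i₂', integral_add_measure i₂ i₃]
  simp only [integral_smul_measure, ENNReal.toReal_ofReal hp.1, ENNReal.toReal_ofReal hq,
    smul_eq_mul]
  ring

namespace SystemParams

variable (S : SystemParams)

lemma v_pos : 0 < S.v := by
  have := S.ra_pos
  have := S.ωb_pos
  have := Real.pi_pos
  unfold v
  positivity

lemma A₀_pos : 0 < S.A₀ := pow_pos (erf_pos S.v_pos) 2

lemma ωe_pos : 0 < S.ωe := by
  have := S.ωb_pos
  have := Real.pi_pos
  have := S.v_pos
  have := erf_pos S.v_pos
  unfold ωe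
  positivity

lemma μs_pos : 0 < S.μs := by
  have := S.ωe_pos
  have := S.σs_pos
  unfold μs
  positivity

lemma ha_pos : 0 < S.ha := Real.exp_pos _

lemma avgSNR_pos : 0 < S.avgSNR := by
  have := sub_pos.2 S.ρ_mem.2
  have := S.ηr_pos
  have := S.ηt_pos
  have := S.ηs_pos
  have := S.Pt_pos
  have := S.σ₂_pos
  unfold avgSNR
  positivity

/-- The deterministic factor of the SNR. -/
def snrScale : ℝ := S.avgSNR * (S.ha * S.A₀) ^ 2

lemma snrScale_pos : 0 < S.snrScale := by
  have := S.avgSNR_pos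
  have := S.ha_pos
  have := S.A₀_pos
  unfold snrScale
  positivity

/-- The pointing loss relative to its maximum. -/
def relativeLoss (p : ℝ × ℝ) : ℝ := Real.exp (-(2 / S.ωe ^ 2 * (p.1 ^ 2 + p.2 ^ 2)))

lemma measurable_relativeLoss : Measurable S.relativeLoss := by
  unfold relativeLoss; fun_prop

lemma pointingLoss_eq (p : ℝ × ℝ) : S.pointingLoss p = S.A₀ * S.relativeLoss p := by
  rw [pointingLoss, relativeLoss, Real.sq_sqrt (by positivity)]
  congr 2
  ring

/-- The exponent `2r²/ω_e²` is exponential with rate `ω_e²/(4σ_s²)`, which is `μ_s²`. -/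
lemma map_relativeLoss_jitterMeasure :
    S.jitterMeasure.map S.relativeLoss =
      (gammaMeasure 1 (S.μs ^ 2)).map fun x => Real.exp (-x) := by
  have hω := S.ωe_pos
  have hσ := S.σs_pos
  have hμ : S.μs ^ 2 = 1 / (2 * S.σs ^ 2 * (2 / S.ωe ^ 2)) := by
    rw [μs]; field_simp
  rw [hμ, ← map_sq_add_sq_gaussianReal hσ (by positivity : 0 < 2 / S.ωe ^ 2),
    Measure.map_map (by fun_prop) (by fun_prop)]
  rfl

/-- The exponential law is the generalized Gamma law with both shapes 1, so a single computation
serves every pair of components. -/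
lemma eggMeasure_eq : S.eggMeasure = ENNReal.ofReal S.α • genGammaMeasure 1 S.β 1 +
    ENNReal.ofReal (1 - S.α) • genGammaMeasure S.a S.b S.c := by
  have hq : 0 ≤ 1 - S.α := sub_nonneg.2 S.α_mem.2
  rw [genGammaMeasure, genGammaMeasure,
    ← withDensity_smul _ (measurable_genGammaDensity _ _ _).ennreal_ofReal,
    ← withDensity_smul _ (measurable_genGammaDensity _ _ _).ennreal_ofReal,
    ← withDensity_add_left ((measurable_genGammaDensity _ _ _).ennreal_ofReal.const_smul _),
    eggMeasure]
  congr 1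
  ext x
  simp only [Pi.add_apply, Pi.smul_apply, smul_eq_mul]
  rw [← ENNReal.ofReal_mul S.α_mem.1, ← ENNReal.ofReal_mul hq, ← ENNReal.ofReal_add
    (mul_nonneg S.α_mem.1 (genGammaDensity_nonneg one_pos S.β_pos one_pos _))
    (mul_nonneg hq (genGammaDensity_nonneg S.a_pos S.b_pos S.c_pos _))]
  congr 1
  simp only [eggDensity, genGammaDensity]
  split_ifs with hx
  · simp only [mul_one, sub_self, Real.rpow_zero, Real.rpow_one, Real.Gamma_one]
    rw [neg_div]
    ring
  · simp

lemma ae_pos_eggMeasure : ∀ᵐ t ∂S.eggMeasure, 0 < t := by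
  rw [eggMeasure_eq, ae_add_measure_iff]
  exact ⟨Measure.ae_smul_measure ae_pos_genGammaMeasure _,
    Measure.ae_smul_measure ae_pos_genGammaMeasure _⟩

instance : SFinite S.eggMeasure := by
  unfold eggMeasure; infer_instance

/-- The mean of `logPowKernel` over the products of the fading components. -/
def fadingMean (x : ℝ) : ℝ :=
  S.α ^ 2 * genGammaMixture (S.μs ^ 2) 1 S.β 1 1 S.β 1 x +
    2 * S.α * (1 - S.α) * genGammaMixture (S.μs ^ 2) S.a S.b S.c 1 S.β 1 x +
      (1 - S.α) ^ 2 * genGammaMixture (S.μs ^ 2) S.a S.b S.c S.a S.b S.c x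

lemma integrable_and_integral_eggMeasure {x : ℝ} (hx : 0 < x) :
    Integrable (fun t => logPowKernel (S.μs ^ 2) (x / t)) (S.eggMeasure ∗ₘ S.eggMeasure) ∧
    ∫ t, logPowKernel (S.μs ^ 2) (x / t) ∂(S.eggMeasure ∗ₘ S.eggMeasure) = S.fadingMean x := by
  -- These positivity facts serve as the contour conditions for `σ = 0`.
  have hm : 0 < S.μs ^ 2 := pow_pos S.μs_pos 2
  have hac : 0 < S.a * S.c := mul_pos S.a_pos S.c_pos
  have h1 : (0 : ℝ) < 1 * 1 := by norm_num
  rw [eggMeasure_eq]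
  exact integral_mixture_mconv_self S.α_mem
    (integrable_logPowKernel_genGamma one_pos S.β_pos one_pos one_pos S.β_pos one_pos hm h1 h1 hx)
    (integrable_logPowKernel_genGamma S.a_pos S.b_pos S.c_pos one_pos S.β_pos one_pos hm hac h1 hx)
    (integrable_logPowKernel_genGamma S.a_pos S.b_pos S.c_pos S.a_pos S.b_pos S.c_pos hm hac hac hx)

/-! ### The law of the SNR under the channel model -/

variable {Ω : Type*} [MeasurableSpace Ω] {P : Measure Ω}
  {ht : Fin 2 → Ω → ℝ} {disp : Fin 2 → Ω → ℝ × ℝ}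

variable {S}

lemma IsChannel.aemeasurable_snr (hS : S.IsChannel P ht disp) : AEMeasurable (S.snr ht disp) P := by
  have h0 := (hS.fading_law 0).aemeasurable
  have h1 := (hS.fading_law 1).aemeasurable
  have hl : Measurable S.pointingLoss := by unfold pointingLoss; fun_prop
  have d0 := hl.comp_aemeasurable (hS.jitter_law 0).aemeasurable
  have d1 := hl.comp_aemeasurable (hS.jitter_law 1).aemeasurable
  exact (((h0.const_mul _).mul d0).mul ((h1.const_mul _).mul d1)).const_mul _

lemma IsChannel.map_fading_mul_relativeLoss [IsProbabilityMeasure P]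
    (hS : S.IsChannel P ht disp) (i : Fin 2) :
    P.map (ht i * S.relativeLoss ∘ disp i) =
      S.eggMeasure ∗ₘ (gammaMeasure 1 (S.μs ^ 2)).map fun x => Real.exp (-x) := by
  have hd := (hS.jitter_law i).aemeasurable
  have hind : IndepFun (ht i) (S.relativeLoss ∘ disp i) P := by
    -- Independence is assumed of the loss rather than of the displacement; dividing the loss by `A₀
    -- ≠ 0` recovers the relative loss.
    have h := (hS.indep_loss i).comp measurable_id (measurable_id.div_const S.A₀)
    have e : S.relativeLoss ∘ disp i = (fun x => id x / S.A₀) ∘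
        fun ω => S.pointingLoss (disp i ω) := by
      ext ω
      simp only [Function.comp_apply, id, pointingLoss_eq]
      exact (mul_div_cancel_left₀ _ S.A₀_pos.ne').symm
    rw [e]
    exact h
  rw [hind.map_mul_eq_map_mconv_map₀ (hS.fading_law i).aemeasurable
    (S.measurable_relativeLoss.comp_aemeasurable hd), (hS.fading_law i).map_eq,
    ← AEMeasurable.map_map_of_aemeasurable S.measurable_relativeLoss.aemeasurable hd,
    (hS.jitter_law i).map_eq, map_relativeLoss_jitterMeasure]

lemma IsChannel.map_snr [IsProbabilityMeasure P] (hS : S.IsChannel P ht disp) :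
    P.map (S.snr ht disp) = ((S.eggMeasure ∗ₘ S.eggMeasure) ∗ₘ
      (gammaMeasure 2 (S.μs ^ 2)).map fun x => Real.exp (-x)).map fun x => S.snrScale * x := by
  have hm : 0 < S.μs ^ 2 := pow_pos S.μs_pos 2
  have := isProbabilityMeasure_gammaMeasure one_pos hm
  have hA := S.A₀_pos
  have hh := S.ha_pos
  have hmeas : ∀ i, AEMeasurable (ht i * S.relativeLoss ∘ disp i) P := fun i =>
    (hS.fading_law i).aemeasurable.mul
      (S.measurable_relativeLoss.comp_aemeasurable (hS.jitter_law i).aemeasurable)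
  have hind : IndepFun (ht 0 * S.relativeLoss ∘ disp 0) (ht 1 * S.relativeLoss ∘ disp 1) P := by
    have h := hS.indep_links.comp (measurable_id.div_const (S.ha * S.A₀))
      (measurable_id.div_const (S.ha * S.A₀))
    have e : ∀ i, ht i * S.relativeLoss ∘ disp i = (fun x => id x / (S.ha * S.A₀)) ∘
        fun ω => S.linkGain (ht i ω) (disp i ω) := by
      intro i
      ext ω
      simp only [Pi.mul_apply, Function.comp_apply, id, linkGain, pointingLoss_eq]
      field_simp
    rw [e 0, e 1]
    exact h
  have hsnr : S.snr ht disp = (fun x => S.snrScale * x) ∘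
      ((ht 0 * S.relativeLoss ∘ disp 0) * (ht 1 * S.relativeLoss ∘ disp 1)) := by
    ext ω
    simp only [snr, linkGain, pointingLoss_eq, snrScale, Pi.mul_apply, Function.comp_apply]
    ring
  rw [hsnr, ← AEMeasurable.map_map_of_aemeasurable (by fun_prop) ((hmeas 0).mul (hmeas 1)),
    hind.map_mul_eq_map_mconv_map₀ (hmeas 0) (hmeas 1), hS.map_fading_mul_relativeLoss,
    hS.map_fading_mul_relativeLoss, mconv_mconv_mconv_comm, map_exp_neg_mconv,
    gammaMeasure_one_conv_self hm]

/-! ### Density, distribution function and outage probability of the SNR -/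

variable (S) in
/-- The density of the SNR. -/
def snrDensity (y : ℝ) : ℝ :=
  mixtureDensity (S.μs ^ 2) S.snrScale (S.eggMeasure ∗ₘ S.eggMeasure) y

variable (S) in
lemma snrDensity_nonneg (y : ℝ) : 0 ≤ S.snrDensity y :=
  mixtureDensity_nonneg S.snrScale_pos (ae_pos_mconv S.ae_pos_eggMeasure S.ae_pos_eggMeasure) y

variable (S) in
lemma measurable_snrDensity : Measurable S.snrDensity := measurable_mixtureDensity _ _ _

variable (S) in
lemma snrDensity_of_pos {y : ℝ} (hy : 0 < y) :
    S.snrDensity y = (S.μs ^ 2) ^ 2 / y * S.fadingMean (y / S.snrScale) := by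
  rw [snrDensity, mixtureDensity, if_pos hy,
    (S.integrable_and_integral_eggMeasure (div_pos hy S.snrScale_pos)).2]

variable (S) in
lemma snrDensity_of_nonpos {y : ℝ} (hy : y ≤ 0) : S.snrDensity y = 0 := by
  rw [snrDensity, mixtureDensity, if_neg hy.not_gt]

lemma IsChannel.map_snr_eq_withDensity [IsProbabilityMeasure P] (hS : S.IsChannel P ht disp) :
    P.map (S.snr ht disp) = volume.withDensity fun y => ENNReal.ofReal (S.snrDensity y) := by
  rw [hS.map_snr]
  exact map_mul_mconv_eq_withDensity (pow_pos S.μs_pos 2) S.snrScale_pos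
    (ae_pos_mconv S.ae_pos_eggMeasure S.ae_pos_eggMeasure)
    fun x hx => (S.integrable_and_integral_eggMeasure hx).1

lemma IsChannel.cdf_snr [IsProbabilityMeasure P] (hS : S.IsChannel P ht disp) {y : ℝ} (hy : 0 < y) :
    cdf (P.map (S.snr ht disp)) y =
      (S.μs ^ 2) ^ 2 * ∫ g in Set.Ioc 0 (y / S.snrScale), S.fadingMean g / g := by
  have hK := S.snrScale_pos
  have := Measure.isProbabilityMeasure_map hS.aemeasurable_snr
  rw [cdf_eq_real, hS.map_snr_eq_withDensity, measureReal_def,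
    withDensity_apply _ measurableSet_Iic, ← integral_eq_lintegral_of_nonneg_ae
      (Filter.Eventually.of_forall S.snrDensity_nonneg)
      S.measurable_snrDensity.aestronglyMeasurable,
    setIntegral_eq_of_subset_of_forall_sdiff_eq_zero measurableSet_Iic
      (Set.Ioc_subset_Iic_self : Set.Ioc 0 y ⊆ Set.Iic y)
      fun x hx => S.snrDensity_of_nonpos (not_lt.1 fun h => hx.2 ⟨h, hx.1⟩)]
  -- Prepares the substitution `g = x / K`, with `K` the scale of the SNR.
  have h : ∀ x ∈ Set.Ioc 0 y, S.snrDensity x = ((S.μs ^ 2) ^ 2 / S.snrScale) *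
      (S.fadingMean (x / S.snrScale) / (x / S.snrScale)) := by
    intro x hx
    have hx0 := hx.1
    rw [S.snrDensity_of_pos hx0]
    field_simp
  rw [setIntegral_congr_fun measurableSet_Ioc h, integral_const_mul,
    ← intervalIntegral.integral_of_le hy.le, ← intervalIntegral.integral_of_le (by positivity),
    intervalIntegral.integral_comp_div (fun g => S.fadingMean g / g) hK.ne', zero_div, smul_eq_mul]
  field_simp

/-- The strict and weak inequalities differ by a point, which is null for an absolutely continuous
law. -/
lemma IsChannel.measureReal_snr_lt [IsProbabilityMeasure P] (hS : S.IsChannel P ht disp) (y : ℝ) :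
    P.real {ω | S.snr ht disp ω < y} = cdf (P.map (S.snr ht disp)) y := by
  have := Measure.isProbabilityMeasure_map hS.aemeasurable_snr
  have h1 : P.real {ω | S.snr ht disp ω < y} = (P.map (S.snr ht disp)).real (Set.Iio y) := by
    rw [measureReal_def, measureReal_def,
      Measure.map_apply_of_aemeasurable hS.aemeasurable_snr measurableSet_Iio]
    rfl
  have hac : P.map (S.snr ht disp) ≪ volume := by
    rw [hS.map_snr_eq_withDensity]
    exact withDensity_absolutelyContinuous _ _
  rw [h1, cdf_eq_real, measureReal_def, measureReal_def,
    measure_congr (hac.ae_le (Iio_ae_eq_Iic : Set.Iio y =ᵐ[volume] Set.Iic y))]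

end SystemParams

namespace SystemParams

variable (S : SystemParams) {γ : ℝ}

/-! ### The special functions of the SNR -/

/-- The contribution of a pair of fading components to the distribution function of the SNR. -/
def mixturePrimitive (a₁ b₁ c₁ a₂ b₂ c₂ x : ℝ) : ℝ :=
  ∫ g in Set.Ioc 0 x, genGammaMixture (S.μs ^ 2) a₁ b₁ c₁ a₂ b₂ c₂ g / g

lemma integral_fadingMean_div (x : ℝ) :
    ∫ g in Set.Ioc 0 x, S.fadingMean g / g =
      S.α ^ 2 * S.mixturePrimitive 1 S.β 1 1 S.β 1 x +
        2 * S.α * (1 - S.α) * S.mixturePrimitive S.a S.b S.c 1 S.β 1 x +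
          (1 - S.α) ^ 2 * S.mixturePrimitive S.a S.b S.c S.a S.b S.c x := by
  have hm : 0 < S.μs ^ 2 := pow_pos S.μs_pos 2
  have hi : ∀ {a₁ b₁ c₁ a₂ b₂ c₂ : ℝ}, 0 < a₁ → 0 < b₁ → 0 < c₁ → 0 < a₂ → 0 < b₂ → 0 < c₂ →
      IntegrableOn (fun g => genGammaMixture (S.μs ^ 2) a₁ b₁ c₁ a₂ b₂ c₂ g / g) (Set.Ioc 0 x) := by
    intro a₁ b₁ c₁ a₂ b₂ c₂ ha₁ hb₁ hc₁ ha₂ hb₂ hc₂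
    obtain ⟨σ, ⟨h, h₁, h₂⟩, h0⟩ := exists_pos_contour ha₁ hc₁ ha₂ hc₂ hm
    exact integrableOn_genGammaMixture_div ha₁ hb₁ hc₁ ha₂ hb₂ hc₂ h h₁ h₂ h0 x
  have i₁ := (hi one_pos S.β_pos one_pos one_pos S.β_pos one_pos).const_mul (S.α ^ 2)
  have i₂ := (hi S.a_pos S.b_pos S.c_pos one_pos S.β_pos one_pos).const_mul
    (2 * S.α * (1 - S.α))
  have i₃ := (hi S.a_pos S.b_pos S.c_pos S.a_pos S.b_pos S.c_pos).const_mul ((1 - S.α) ^ 2)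
  simp only [mixturePrimitive]
  rw [← integral_const_mul, ← integral_const_mul, ← integral_const_mul, ← integral_add i₁ i₂,
    ← integral_add (by exact i₁.add i₂) i₃]
  congr 1
  ext g
  rw [fadingMean]
  ring

/-- Multiplied by the scales of its pair of components, each of the three arguments becomes the same
`γ / K`, with `K` the scale of the SNR. -/
lemma argExp_mul : S.argExp γ * S.β * S.β = γ / S.snrScale := by
  have := S.avgSNR_pos
  have := S.ha_pos
  have := S.A₀_pos
  have := S.β_pos
  unfold argExp snrScale
  field_simp

lemma argCross_mul : S.argCross γ * S.b * S.β = γ / S.snrScale := by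
  have := S.avgSNR_pos
  have := S.ha_pos
  have := S.A₀_pos
  have := S.β_pos
  have := S.b_pos
  unfold argCross snrScale
  field_simp

lemma argGamma_base_mul :
    γ * S.avgSNR⁻¹ / (S.A₀ * S.ha * S.b) ^ 2 * S.b * S.b = γ / S.snrScale := by
  have := S.avgSNR_pos
  have := S.ha_pos
  have := S.A₀_pos
  have := S.b_pos
  unfold snrScale
  field_simp

variable (hγ : 0 < γ)

include hγ

lemma argExp_pos : 0 < S.argExp γ := by
  have := S.avgSNR_pos
  have := S.ha_pos
  have := S.A₀_pos
  have := S.β_pos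
  unfold argExp
  positivity

lemma argCross_pos : 0 < S.argCross γ := by
  have := S.avgSNR_pos
  have := S.ha_pos
  have := S.A₀_pos
  have := S.β_pos
  have := S.b_pos
  unfold argCross
  positivity

lemma argGamma_base_pos : 0 < γ * S.avgSNR⁻¹ / (S.A₀ * S.ha * S.b) ^ 2 := by
  have := S.avgSNR_pos
  have := S.ha_pos
  have := S.A₀_pos
  have := S.b_pos
  positivity

lemma isFoxH_density_exp :
    IsFoxH 4 0 (unitCoeffs [S.μs ^ 2 + 1, S.μs ^ 2 + 1]) (unitCoeffs [1, S.μs ^ 2, 1, S.μs ^ 2])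
      (S.argExp γ : ℂ)
      ((genGammaMixture (S.μs ^ 2) 1 S.β 1 1 S.β 1 (γ / S.snrScale) : ℝ) : ℂ) := by
  have h := isFoxH_four_zero one_pos S.β_pos one_pos one_pos S.β_pos one_pos
    (pow_pos S.μs_pos 2) one_pos (S.argExp_pos hγ)
  rw [S.argExp_mul] at h
  simpa only [unitCoeffs, List.map_cons, List.map_nil, div_one,
    one_pow, one_mul, Real.Gamma_one] using h

lemma isFoxH_density_cross :
    IsFoxH 4 0 [(S.μs ^ 2 / S.c + 1, 1 / S.c), (S.μs ^ 2 / S.c + 1, 1 / S.c)]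
      [(S.a, 1 / S.c), (S.μs ^ 2 / S.c, 1 / S.c), (1, 1), (S.μs ^ 2 / S.c, 1 / S.c)]
      (S.argCross γ : ℂ)
      ((S.c ^ 2 * (Real.Gamma S.a *
        genGammaMixture (S.μs ^ 2) S.a S.b S.c 1 S.β 1 (γ / S.snrScale)) : ℝ) : ℂ) := by
  have h := isFoxH_four_zero S.a_pos S.b_pos S.c_pos one_pos S.β_pos one_pos
    (pow_pos S.μs_pos 2) S.c_pos (S.argCross_pos hγ)
  rw [S.argCross_mul] at h
  simpa only [div_one, mul_one, Real.Gamma_one] using h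

/-- All coefficients equal `1/c` here, so rescaling by `c` yields unit coefficients, raises the
argument to the power `c` and divides the value by `c`. -/
lemma isFoxH_density_gamma :
    IsFoxH 4 0 (unitCoeffs [S.μs ^ 2 / S.c + 1, S.μs ^ 2 / S.c + 1])
      (unitCoeffs [S.a, S.μs ^ 2 / S.c, S.a, S.μs ^ 2 / S.c]) (S.argGamma γ : ℂ)
      ((S.c ^ 2 * (Real.Gamma S.a * Real.Gamma S.a *
        genGammaMixture (S.μs ^ 2) S.a S.b S.c S.a S.b S.c (γ / S.snrScale)) : ℝ) / (S.c : ℂ)) := by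
  have h := isFoxH_four_zero S.a_pos S.b_pos S.c_pos S.a_pos S.b_pos S.c_pos
    (pow_pos S.μs_pos 2) S.c_pos (S.argGamma_base_pos hγ)
  rw [S.argGamma_base_mul] at h
  simpa only [unitCoeffs, argGamma, List.map_cons, List.map_nil,
    one_div_mul_cancel S.c_pos.ne'] using
    h.rescale S.c_pos (S.argGamma_base_pos hγ)

lemma isFoxH_cdf_exp :
    IsFoxH 4 1 (unitCoeffs [1, S.μs ^ 2 + 1, S.μs ^ 2 + 1])
      (unitCoeffs [1, S.μs ^ 2, 1, S.μs ^ 2, 0]) (S.argExp γ : ℂ)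
      ((S.mixturePrimitive 1 S.β 1 1 S.β 1 (γ / S.snrScale) : ℝ) : ℂ) := by
  have h := isFoxH_four_one one_pos S.β_pos one_pos one_pos S.β_pos one_pos
    (pow_pos S.μs_pos 2) one_pos one_pos (S.argExp_pos hγ)
  rw [S.argExp_mul] at h
  simpa only [unitCoeffs, mixturePrimitive, List.map_cons, List.map_nil, div_one,
    one_pow, one_mul, Real.Gamma_one] using h

lemma isFoxH_cdf_cross :
    IsFoxH 4 1 [(1, 1), (S.μs ^ 2 / S.c + 1, 1 / S.c), (S.μs ^ 2 / S.c + 1, 1 / S.c)]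
      [(S.a, 1 / S.c), (S.μs ^ 2 / S.c, 1 / S.c), (1, 1), (S.μs ^ 2 / S.c, 1 / S.c), (0, 1)]
      (S.argCross γ : ℂ)
      ((S.c ^ 2 * (Real.Gamma S.a *
        S.mixturePrimitive S.a S.b S.c 1 S.β 1 (γ / S.snrScale)) : ℝ) : ℂ) := by
  have h := isFoxH_four_one S.a_pos S.b_pos S.c_pos one_pos S.β_pos one_pos
    (pow_pos S.μs_pos 2) S.c_pos one_pos (S.argCross_pos hγ)
  rw [S.argCross_mul] at h
  simpa only [mixturePrimitive, div_one, mul_one, Real.Gamma_one] using h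

lemma isFoxH_cdf_gamma :
    IsFoxH 4 1 (unitCoeffs [1, S.μs ^ 2 / S.c + 1, S.μs ^ 2 / S.c + 1])
      (unitCoeffs [S.a, S.μs ^ 2 / S.c, S.a, S.μs ^ 2 / S.c, 0]) (S.argGamma γ : ℂ)
      ((S.c ^ 2 * S.c * (Real.Gamma S.a * Real.Gamma S.a *
        S.mixturePrimitive S.a S.b S.c S.a S.b S.c (γ / S.snrScale)) : ℝ) / (S.c : ℂ)) := by
  -- The choice `d = c` makes the coefficients of the additional pair `1/c` too, so that the
  -- rescaling sends them to 1.
  have h := isFoxH_four_one S.a_pos S.b_pos S.c_pos S.a_pos S.b_pos S.c_pos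
    (pow_pos S.μs_pos 2) S.c_pos S.c_pos (S.argGamma_base_pos hγ)
  rw [S.argGamma_base_mul] at h
  simpa only [unitCoeffs, argGamma, mixturePrimitive, List.map_cons, List.map_nil,
    one_div_mul_cancel S.c_pos.ne'] using
    h.rescale S.c_pos (S.argGamma_base_pos hγ)

end SystemParams

end

/-! ### The closed forms for the SNR -/

theorem theorem3 {Ω : Type*} [MeasurableSpace Ω] (P : Measure Ω) [IsProbabilityMeasure P]
    (S : SystemParams) (ht : Fin 2 → Ω → ℝ) (disp : Fin 2 → Ω → ℝ × ℝ)
    (hS : S.IsChannel P ht disp) :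
    -- the Mellin-Barnes integrals of the special functions below are well defined
    (∀ γ : ℝ, 0 < γ →
      MeijerGConverges 4 0 [S.μs ^ 2 + 1, S.μs ^ 2 + 1] [1, S.μs ^ 2, 1, S.μs ^ 2]
        (S.argExp γ : ℂ) ∧
      FoxHConverges 4 0
        [(S.μs ^ 2 / S.c + 1, 1 / S.c), (S.μs ^ 2 / S.c + 1, 1 / S.c)]
        [(S.a, 1 / S.c), (S.μs ^ 2 / S.c, 1 / S.c), (1, 1), (S.μs ^ 2 / S.c, 1 / S.c)]
        (S.argCross γ : ℂ) ∧
      MeijerGConverges 4 0 [S.μs ^ 2 / S.c + 1, S.μs ^ 2 / S.c + 1]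
        [S.a, S.μs ^ 2 / S.c, S.a, S.μs ^ 2 / S.c] (S.argGamma γ : ℂ) ∧
      MeijerGConverges 4 1 [1, S.μs ^ 2 + 1, S.μs ^ 2 + 1] [1, S.μs ^ 2, 1, S.μs ^ 2, 0]
        (S.argExp γ : ℂ) ∧
      FoxHConverges 4 1
        [(1, 1), (S.μs ^ 2 / S.c + 1, 1 / S.c), (S.μs ^ 2 / S.c + 1, 1 / S.c)]
        [(S.a, 1 / S.c), (S.μs ^ 2 / S.c, 1 / S.c), (1, 1), (S.μs ^ 2 / S.c, 1 / S.c), (0, 1)]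
        (S.argCross γ : ℂ) ∧
      MeijerGConverges 4 1 [1, S.μs ^ 2 / S.c + 1, S.μs ^ 2 / S.c + 1]
        [S.a, S.μs ^ 2 / S.c, S.a, S.μs ^ 2 / S.c, 0] (S.argGamma γ : ℂ)) ∧
    -- the probability density function of the SNR
    (∃ f : ℝ → ℝ, Measurable f ∧ (∀ γ, 0 ≤ f γ) ∧ (∀ γ ≤ 0, f γ = 0) ∧
      P.map (S.snr ht disp) = volume.withDensity (fun γ => ENNReal.ofReal (f γ)) ∧
      ∀ γ : ℝ, 0 < γ →
        (f γ : ℂ) =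
          (((S.α * S.μs ^ 2) ^ 2 / γ : ℝ) : ℂ) *
            meijerG 4 0 [S.μs ^ 2 + 1, S.μs ^ 2 + 1] [1, S.μs ^ 2, 1, S.μs ^ 2]
              (S.argExp γ : ℂ) +
          ((2 * S.α * (1 - S.α) * S.μs ^ 4 / (Real.Gamma S.a * S.c ^ 2 * γ) : ℝ) : ℂ) *
            foxH 4 0
              [(S.μs ^ 2 / S.c + 1, 1 / S.c), (S.μs ^ 2 / S.c + 1, 1 / S.c)]
              [(S.a, 1 / S.c), (S.μs ^ 2 / S.c, 1 / S.c), (1, 1), (S.μs ^ 2 / S.c, 1 / S.c)]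
              (S.argCross γ : ℂ) +
          ((((1 - S.α) * S.μs ^ 2 / Real.Gamma S.a) ^ 2 * (1 / (S.c * γ)) : ℝ) : ℂ) *
            meijerG 4 0 [S.μs ^ 2 / S.c + 1, S.μs ^ 2 / S.c + 1]
              [S.a, S.μs ^ 2 / S.c, S.a, S.μs ^ 2 / S.c] (S.argGamma γ : ℂ)) ∧
    -- the cumulative distribution function of the SNR, and the outage probability at `γ`
    (∀ γ : ℝ, 0 < γ →
      (cdf (P.map (S.snr ht disp)) γ : ℂ) =
          (((S.α * S.μs ^ 2) ^ 2 : ℝ) : ℂ) *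
            meijerG 4 1 [1, S.μs ^ 2 + 1, S.μs ^ 2 + 1] [1, S.μs ^ 2, 1, S.μs ^ 2, 0]
              (S.argExp γ : ℂ) +
          ((2 * S.α * (1 - S.α) * S.μs ^ 4 / (Real.Gamma S.a * S.c ^ 2) : ℝ) : ℂ) *
            foxH 4 1
              [(1, 1), (S.μs ^ 2 / S.c + 1, 1 / S.c), (S.μs ^ 2 / S.c + 1, 1 / S.c)]
              [(S.a, 1 / S.c), (S.μs ^ 2 / S.c, 1 / S.c), (1, 1), (S.μs ^ 2 / S.c, 1 / S.c),
                (0, 1)]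
              (S.argCross γ : ℂ) +
          ((((1 - S.α) * S.μs ^ 2 / (Real.Gamma S.a * S.c)) ^ 2 : ℝ) : ℂ) *
            meijerG 4 1 [1, S.μs ^ 2 / S.c + 1, S.μs ^ 2 / S.c + 1]
              [S.a, S.μs ^ 2 / S.c, S.a, S.μs ^ 2 / S.c, 0] (S.argGamma γ : ℂ) ∧
      P.real {ω | S.snr ht disp ω < γ} = cdf (P.map (S.snr ht disp)) γ) := by
  have hc : (S.c : ℂ) ≠ 0 := by exact_mod_cast S.c_pos.ne'
  have hG : (Real.Gamma S.a : ℂ) ≠ 0 := by exact_mod_cast (Real.Gamma_pos_of_pos S.a_pos).ne'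
  refine ⟨fun γ hγ => ⟨⟨_, S.isFoxH_density_exp hγ⟩, ⟨_, S.isFoxH_density_cross hγ⟩,
    ⟨_, S.isFoxH_density_gamma hγ⟩, ⟨_, S.isFoxH_cdf_exp hγ⟩, ⟨_, S.isFoxH_cdf_cross hγ⟩,
    ⟨_, S.isFoxH_cdf_gamma hγ⟩⟩, ⟨S.snrDensity, S.measurable_snrDensity, S.snrDensity_nonneg,
    fun γ hγ => S.snrDensity_of_nonpos hγ, hS.map_snr_eq_withDensity, fun γ hγ => ?_⟩,
    fun γ hγ => ⟨?_, hS.measureReal_snr_lt γ⟩⟩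
  · have hγ' : (γ : ℂ) ≠ 0 := by exact_mod_cast hγ.ne'
    rw [meijerG, meijerG, (S.isFoxH_density_exp hγ).foxH_eq, (S.isFoxH_density_cross hγ).foxH_eq,
      (S.isFoxH_density_gamma hγ).foxH_eq, S.snrDensity_of_pos hγ, SystemParams.fadingMean]
    push_cast
    field_simp
  · rw [meijerG, meijerG, (S.isFoxH_cdf_exp hγ).foxH_eq, (S.isFoxH_cdf_cross hγ).foxH_eq,
      (S.isFoxH_cdf_gamma hγ).foxH_eq, hS.cdf_snr hγ, S.integral_fadingMean_div]
    push_cast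
    field_simp
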